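/- **Theorem (contraction and cut on the BR polynomial).** A ribbon graph with flags $\mathcal{G}=\mathcal{G}(\mathcal{V},\mathcal{E},\mathfrak{f}^0)$ is a finite, not necessarily orientable, ribbon graph (vertex discs with edge ribbons, each edge attached along two segments of the vertex boundaries) together with finitely many flags, i.e. half-ribbons attached to a vertex along one segment, whose opposite segment is free and has two end points, the external points of the flag. Cutting an edge $e$ replaces it by two flags attached where its ends were; the result is $\mathcal{G}\vee e$. A spanning c-subgraph $A\Subset\mathcal{G}$ is obtained from $\mathcal{G}$ by keeping all vertices and all flags and cutting all edges outside a subset $\mathcal{E}_A\subseteq\mathcal{E}$. For such $A$ let $k(A)$ be its number of connected components, ${\rm r}(A)=|\mathcal{V}|-k(A)$, $n(A)=|\mathcal{E}_A|-{\rm r}(A)$, and let $f(A)$ be its number of flags. A boundary component of the ribbon graph which never passes through the free segment of a flag is a closed face; $F_{\rm int}(A)$ is the number of closed faces. The parts of the boundary running from an external point of a flag to the next external point are the open faces. The boundary graph $\partial A$ has the flags of $A$ as vertices and the open faces of $A$ as edges, and $C_\partial(A)$ is its number of connected components. Put $$\mathcal{R}_{\mathcal{G}}(x,y,z,s,t)=\sum_{A\Subset\mathcal{G}}(x-1)^{{\rm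 r}(\mathcal{G})-{\rm r}(A)}(y-1)^{n(A)}z^{k(A)-F_{\rm int}(A)+n(A)}s^{C_\partial(A)}t^{f(A)} .$$ Let $\mathcal{G}-e$ denote the removal of the ribbon $e$, keeping the vertex discs. A self-loop $e$ at a vertex $v$ divides the remaining half-ribbons at $v$ into two sides $P,Q$ (the two arcs of the boundary of $v$ between the ends of $e$). It is untwisted if $v\cup e$ is an annulus and twisted if $v\cup e$ is a Möbius band. It is trivial if no cycle of $\mathcal{G}$ is interlaced with it, i.e. no path avoiding $v$ leads from a half-edge in $P$ to a half-edge in $Q$ (in particular no other loop at $v$ has one end in each). The edge $e$ is a bridge if removing it disconnects a component of $\mathcal{G}$, and regular if it is neither a self-loop nor a bridge. The contraction $\mathcal{G}/e$ is defined as follows. If $e$ is not a self-loop, $e$ and its two end vertices are replaced by one vertex disc bounded by the boundary of their union, carrying all their remaining edges and flags in the same cyclic order. If $e$ is a trivial twisted self-loop, $\mathcal{G}/e=\mathcal{G}-e$. If $e$ is a trivial untwisted self-loop at $v$, then $e$ and $v$ are replaced by two vertex discs bounded by the two boundary circles of the annulus $v\cup e$, one carrying the half-ribbons of $P$ and the other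 those of $Q$; in particular, if one of the two sides is empty, $\mathcal{G}/e=(\mathcal{G}-e)\sqcup\{v_0\}$ with a new isolated vertex $v_0$. Then, for every ribbon graph with flags $\mathcal{G}$ and every edge $e$ of $\mathcal{G}$: * if $e$ is regular, $\mathcal{R}_{\mathcal{G}}=\mathcal{R}_{\mathcal{G}\vee e}+\mathcal{R}_{\mathcal{G}/e}$; * if $e$ is a bridge, $\mathcal{R}_{\mathcal{G}}=(x-1)\,\mathcal{R}_{\mathcal{G}\vee e}+\mathcal{R}_{\mathcal{G}/e}$; * if $e$ is a trivial twisted self-loop, $\mathcal{R}_{\mathcal{G}}=\mathcal{R}_{\mathcal{G}\vee e}+(y-1)z\,\mathcal{R}_{\mathcal{G}/e}$; * if $e$ is a trivial untwisted self-loop, $\mathcal{R}_{\mathcal{G}}=\mathcal{R}_{\mathcal{G}\vee e}+(y-1)\,\mathcal{R}_{\mathcal{G}/e}$; in particular, if one side of $e$ is empty, $\mathcal{R}_{\mathcal{G}}=\mathcal{R}_{\mathcal{G}\vee e}+(y-1)\,\mathcal{R}_{(\mathcal{G}-e)\sqcup\{v_0\}}$. -/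

import Mathlib

/-- A (finite) ribbon graph with flags, not necessarily orientable, presented combinatorially.

`H` is the set of half-ribbons (half-edges). Each `h : H` is glued to the boundary circle of a
vertex disc along a segment whose two end points are the *crosses* `(h, false)` and `(h, true)`.

* `pair h` is the other half of the ribbon edge of `h`; the fixed points of `pair` are the flags.
  The labels of the crosses are chosen such that the two strands (free sides) of the ribbon edge
  `{h, pair h}` join `(h, b)` to `(pair h, b)`; whether a ribbon is twisted is recorded by the way
  in which the labels follow each other around the vertices.
* `arc` joins every cross to the next cross along the boundary circle of its vertex, on the side
  which does not belong to the segment of its own half-ribbon. Thus each vertex circle is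
  made of segments `(h, false) — (h, true)` and of arcs, alternately.
* `isolated` is the number of vertex discs to which no half-ribbon is glued. -/
structure RibbonGraph (H : Type*) where
  pair : H → H
  pair_pair : ∀ h, pair (pair h) = h
  arc : H × Bool → H × Bool
  arc_arc : ∀ x, arc (arc x) = x
  arc_ne : ∀ x, arc x ≠ x
  isolated : ℕ

namespace RibbonGraph

variable {H : Type*}

/-- The cross at the other end of the segment of the same half-ribbon. -/
def flip (x : H × Bool) : H × Bool := (x.1, !x.2)

/-- The cross at the other end of the strand starting at `x` (`x` itself, if `x` is on a flag). -/
def strand (G : RibbonGraph H) (x : H × Bool) : H × Bool := (G.pair x.1, x.2)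

/-- `h` is a flag. -/
def IsFlag (G : RibbonGraph H) (h : H) : Prop := G.pair h = h

/-! ### Vertices, edges, connected components -/

/-- Vertex discs: the circles made of arcs and segments, and the isolated discs. -/
def Vertex (G : RibbonGraph H) : Type _ :=
  Quot (fun x y : H × Bool => y = G.arc x ∨ y = flip x) ⊕ Fin G.isolated

/-- The vertex to which the half-ribbon `h` is attached. -/
def vert (G : RibbonGraph H) (h : H) : G.Vertex := Sum.inl (Quot.mk _ (h, false))

/-- Connected components of the underlying graph. -/
def Component (G : RibbonGraph H) : Type _ :=
  Quot (fun u v : G.Vertex => ∃ h, u = G.vert h ∧ v = G.vert (G.pair h))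

/-- Edges: the unordered pairs of distinct paired half-ribbons. -/
def edges [Fintype H] [DecidableEq H] (G : RibbonGraph H) : Finset (Sym2 H) :=
  (Finset.univ.filter fun h => G.pair h ≠ h).image fun h => s(h, G.pair h)

/-- Number of vertices. -/
noncomputable def numVertices (G : RibbonGraph H) : ℕ := Nat.card G.Vertex

/-- `k(G)`. -/
noncomputable def numComponents (G : RibbonGraph H) : ℕ := Nat.card G.Component

/-- The number of flags, `f(G)`. -/
noncomputable def numFlags (G : RibbonGraph H) : ℕ := Nat.card {h : H // G.IsFlag h}

/-- The rank `r(G) = |V| - k(G)` (always `k(G) ≤ |V|`). -/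
noncomputable def rank (G : RibbonGraph H) : ℕ := G.numVertices - G.numComponents

/-- The nullity `n(G) = |E| + k(G) - |V|` (always `|V| ≤ |E| + k(G)`). -/
noncomputable def nullity [Fintype H] [DecidableEq H] (G : RibbonGraph H) : ℕ :=
  G.edges.card + G.numComponents - G.numVertices

/-! ### Faces and boundary graph -/

/-- The boundary curves which run along the arcs of the vertices and the strands of the edges;
a curve reaching a flag ends at an external point of that flag. The boundaries of
the isolated vertices are not included here. -/
def Face (G : RibbonGraph H) : Type _ :=
  Quot (fun x y : H × Bool => y = G.arc x ∨ y = G.strand x)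

/-- The face passing through the cross `x`. -/
def face (G : RibbonGraph H) (x : H × Bool) : G.Face := Quot.mk _ x

/-- Open (external) faces: those which end at external points of flags. -/
def Face.IsOpen {G : RibbonGraph H} (f : G.Face) : Prop :=
  ∃ x : H × Bool, G.IsFlag x.1 ∧ G.face x = f

/-- The number of closed (internal) faces; the boundary of each isolated vertex is one of them. -/
noncomputable def numClosedFaces (G : RibbonGraph H) : ℕ :=
  Nat.card {f : G.Face // ¬ f.IsOpen} + G.isolated

/-- Connected components of the boundary graph: its vertices are the flags and its edges are the
open faces, an open face being incident to the flags at whose external points it ends. -/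
def BoundaryComponent (G : RibbonGraph H) : Type _ :=
  Quot (fun g h : {h : H // G.IsFlag h} =>
    ∃ f : G.Face, (∃ b, G.face (g.1, b) = f) ∧ ∃ c, G.face (h.1, c) = f)

/-- The number `C_∂(G)` of connected components of the boundary graph. -/
noncomputable def numBoundaryComponents (G : RibbonGraph H) : ℕ := Nat.card G.BoundaryComponent

/-! ### Spanning c-subgraphs and the polynomial -/

/-- The spanning c-subgraph with edge set `A`: all vertices and all flags are kept and every edge
not in `A` is cut into two flags. -/
def sub [DecidableEq H] (G : RibbonGraph H) (A : Finset (Sym2 H)) : RibbonGraph H where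
  pair h := if s(h, G.pair h) ∈ A then G.pair h else h
  pair_pair h := by
    by_cases hA : s(h, G.pair h) ∈ A
    · have hB : s(G.pair h, h) ∈ A := by rwa [Sym2.eq_swap]
      simp [hA, hB, G.pair_pair]
    · simp [hA]
  arc := G.arc
  arc_arc := G.arc_arc
  arc_ne := G.arc_ne
  isolated := G.isolated

open LaurentPolynomial in
/-- The polynomial `ℛ_G(x, y, z, s, t)`, as a Laurent polynomial in `z` over `ℤ[x, y, s, t]`, with
`x, y, s, t` the variables number `0, 1, 2, 3`. -/
noncomputable def brPoly [Fintype H] [DecidableEq H] (G : RibbonGraph H) :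
    LaurentPolynomial (MvPolynomial (Fin 4) ℤ) :=
  ∑ A ∈ G.edges.powerset,
    C ((MvPolynomial.X 0 - 1) ^ (G.rank - (G.sub A).rank)
        * (MvPolynomial.X 1 - 1) ^ (G.sub A).nullity)
      * T (((G.sub A).numComponents : ℤ) - (G.sub A).numClosedFaces + (G.sub A).nullity)
      * C (MvPolynomial.X 2 ^ (G.sub A).numBoundaryComponents
        * MvPolynomial.X 3 ^ (G.sub A).numFlags)

/-! ### Operations on the edge `e = {h, pair h}` -/

/-- The half-ribbon `x` is one of the two halves of the edge of `h`. -/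
def OnEdge (G : RibbonGraph H) (h x : H) : Prop := x = h ∨ x = G.pair h

/-- The half-ribbons other than the two halves of the edge of `h`. -/
abbrev Rest (G : RibbonGraph H) (h : H) : Type _ := {x : H // x ≠ h ∧ x ≠ G.pair h}

/-- The cut graph `G ∨ e`: the edge `e` is replaced by two flags. -/
def cut [DecidableEq H] (G : RibbonGraph H) (h : H) : RibbonGraph H where
  pair x := if x = h ∨ x = G.pair h then x else G.pair x
  pair_pair x := by
    by_cases hx : x = h ∨ x = G.pair h
    · simp [hx]
    · have h1 : ¬ (G.pair x = h ∨ G.pair x = G.pair h) := by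
        rintro (h1 | h1)
        · exact hx (Or.inr (by rw [← h1, G.pair_pair]))
        · exact hx (Or.inl (by rw [← G.pair_pair x, h1, G.pair_pair]))
      simp only [hx, h1, if_false, G.pair_pair]
  arc := G.arc
  arc_arc := G.arc_arc
  arc_ne := G.arc_ne
  isolated := G.isolated

/-- The disjoint union of `G` with one isolated vertex. -/
def addVertex (G : RibbonGraph H) : RibbonGraph H := { G with isolated := G.isolated + 1 }

section splice

variable (G : RibbonGraph H) (h : H) (σ : H × Bool → H × Bool)

/-- If `y` is a cross of `e`, jump to `σ y` and follow the arc there; otherwise stay at `y`. -/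
def spliceStep [DecidableEq H] (y : H × Bool) : H × Bool :=
  if y.1 = h ∨ y.1 = G.pair h then G.arc (σ y) else y

/-- Follow the arc at `x`, passing through the crosses of `e` by means of `σ`. (As `e` has only
four crosses, at most two passages are needed to reach a cross not on `e`.) -/
def spliceArc [DecidableEq H] (x : H × Bool) : H × Bool :=
  G.spliceStep h σ (G.spliceStep h σ (G.arc x))

/-- `σ` pairs the four crosses of `e` among themselves. -/
structure PairsCrosses : Prop where
  on : ∀ y : H × Bool, G.OnEdge h y.1 → G.OnEdge h (σ y).1
  invol : ∀ y : H × Bool, G.OnEdge h y.1 → σ (σ y) = y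
  ne : ∀ y : H × Bool, G.OnEdge h y.1 → σ y ≠ y
  exhaust : ∀ y y' z : H × Bool, G.OnEdge h y.1 → G.OnEdge h y'.1 → G.OnEdge h z.1 →
    y' ≠ y → y' ≠ σ y → z = y ∨ z = σ y ∨ z = y' ∨ z = σ y'

variable {G h σ}

theorem pairsCrosses_flip (hh : G.pair h ≠ h) : G.PairsCrosses h flip where
  on y hy := hy
  invol y _ := by simp [flip]
  ne y _ := by simp [flip, Prod.ext_iff]
  exhaust := by
    rintro ⟨y, b⟩ ⟨y', b'⟩ ⟨z, c⟩ h1 h2 h3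
    simp only [OnEdge] at h1 h2 h3
    rcases h1 with rfl | rfl <;> rcases h2 with rfl | rfl <;> rcases h3 with rfl | rfl <;>
      cases b <;> cases b' <;> cases c <;> simp_all [flip]

theorem pairsCrosses_strand (hh : G.pair h ≠ h) : G.PairsCrosses h G.strand where
  on y hy := by
    rcases hy with hy | hy
    · exact Or.inr (by simp [strand, hy])
    · exact Or.inl (by simp [strand, hy, G.pair_pair])
  invol y _ := by simp [strand, G.pair_pair]
  ne y hy := by
    rcases y with ⟨y, b⟩
    rcases hy with rfl | rfl
    · simpa [strand] using hh
    · simpa [strand, G.pair_pair] using hh.symm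
  exhaust := by
    rintro ⟨y, b⟩ ⟨y', b'⟩ ⟨z, c⟩ h1 h2 h3
    simp only [OnEdge] at h1 h2 h3
    rcases h1 with rfl | rfl <;> rcases h2 with rfl | rfl <;> rcases h3 with rfl | rfl <;>
      cases b <;> cases b' <;> cases c <;> simp_all [strand, G.pair_pair]

theorem spliceStep_on [DecidableEq H] {y : H × Bool} (hy : G.OnEdge h y.1) :
    G.spliceStep h σ y = G.arc (σ y) := if_pos hy

theorem spliceStep_off [DecidableEq H] {y : H × Bool} (hy : ¬ G.OnEdge h y.1) :
    G.spliceStep h σ y = y := if_neg hy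

theorem arc_inj {x y : H × Bool} (hxy : G.arc x = G.arc y) : x = y := by
  rw [← G.arc_arc x, hxy, G.arc_arc]

/-- The spliced arc ends at a cross not on `e`, is involutive and has no fixed point. -/
theorem spliceArc_spec [DecidableEq H] (P : G.PairsCrosses h σ) {x : H × Bool} (hx : ¬ G.OnEdge h x.1) :
    ¬ G.OnEdge h (G.spliceArc h σ x).1 ∧
      G.spliceArc h σ (G.spliceArc h σ x) = x ∧ G.spliceArc h σ x ≠ x := by
  unfold spliceArc
  by_cases h0 : G.OnEdge h (G.arc x).1
  · set y := G.arc x with hy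
    have hyx : G.arc y = x := by rw [hy, G.arc_arc]
    rw [spliceStep_on h0]
    by_cases h1 : G.OnEdge h (G.arc (σ y)).1
    · set w := G.arc (σ y) with hw
      have hwy : G.arc w = σ y := by rw [hw, G.arc_arc]
      rw [spliceStep_on h1]
      have e1 : w ≠ y := by
        intro e
        rw [e, hyx] at hwy
        exact hx (hwy ▸ P.on y h0)
      have e2 : w ≠ σ y := G.arc_ne (σ y)
      have h2 : ¬ G.OnEdge h (G.arc (σ w)).1 := by
        intro h2
        rcases P.exhaust y w _ h0 h1 h2 e1 e2 with e | e | e | e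
        · have : σ w = x := by rw [← hyx, ← e, G.arc_arc]
          exact hx (this ▸ P.on w h1)
        · exact P.ne w h1 (arc_inj (e.trans hwy.symm))
        · have : σ w = σ y := arc_inj (e.trans hw)
          exact e1 (by rw [← P.invol w h1, this, P.invol y h0])
        · exact G.arc_ne _ e
      refine ⟨h2, ?_, ?_⟩
      · rw [G.arc_arc, spliceStep_on (P.on w h1), P.invol w h1, hwy, spliceStep_on (P.on y h0),
          P.invol y h0, hyx]
      · intro e
        have : σ w = y := by rw [hy, ← e, G.arc_arc]
        exact e2 (by rw [← P.invol w h1, this])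
    · rw [spliceStep_off h1]
      refine ⟨h1, ?_, ?_⟩
      · rw [G.arc_arc, spliceStep_on (P.on y h0), P.invol y h0, hyx, spliceStep_off hx]
      · exact fun e => P.ne y h0 (arc_inj (e.trans hyx.symm))
  · rw [spliceStep_off h0, spliceStep_off h0]
    refine ⟨h0, ?_, G.arc_ne x⟩
    rw [G.arc_arc, spliceStep_off hx, spliceStep_off hx]

theorem not_onEdge (x : G.Rest h) : ¬ G.OnEdge h x.1 := fun hx => hx.elim x.2.1 x.2.2

variable (G h σ)

/-- Remove the two half-ribbons of `e` and reconnect the arcs ending at their crosses by means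
of `σ`. Every closed curve made only of arcs and jumps of `σ` becomes the boundary of a new
isolated vertex disc. -/
noncomputable def splice [DecidableEq H] (P : G.PairsCrosses h σ) : RibbonGraph (G.Rest h) where
  pair x := ⟨G.pair x.1, fun hx => x.2.2 ((G.pair_pair x.1).symm.trans (congrArg G.pair hx)),
    fun hx => x.2.1 ((G.pair_pair x.1).symm.trans ((congrArg G.pair hx).trans (G.pair_pair h)))⟩
  pair_pair x := Subtype.ext (G.pair_pair x.1)
  arc x := (⟨(G.spliceArc h σ (x.1.1, x.2)).1,
    fun e => (spliceArc_spec P (x := (x.1.1, x.2)) (not_onEdge x.1)).1 (Or.inl e),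
    fun e => (spliceArc_spec P (x := (x.1.1, x.2)) (not_onEdge x.1)).1 (Or.inr e)⟩,
    (G.spliceArc h σ (x.1.1, x.2)).2)
  arc_arc x := by
    have := (spliceArc_spec P (x := (x.1.1, x.2)) (not_onEdge x.1)).2.1
    exact Prod.ext (Subtype.ext (congrArg (fun y : H × Bool => y.1) this))
      (congrArg (fun y : H × Bool => y.2) this)
  arc_ne x e := (spliceArc_spec P (x := (x.1.1, x.2)) (not_onEdge x.1)).2.2
    (Prod.ext (congrArg (fun y : G.Rest h × Bool => y.1.1) e)
      (congrArg (fun y : G.Rest h × Bool => y.2) e))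
  isolated := G.isolated + Nat.card
    {q : Quot (fun x y : H × Bool => y = G.arc x ∨ (G.OnEdge h x.1 ∧ y = σ x)) //
      ∀ x, Quot.mk _ x = q → G.OnEdge h x.1}

end splice

variable [DecidableEq H]

/-- The deletion `G - e`: the ribbon `e` is removed and the vertex discs are kept, so that each
segment along which `e` was attached becomes part of an arc of the vertex boundary. -/
noncomputable def delete (G : RibbonGraph H) (h : H) (hh : G.pair h ≠ h) :
    RibbonGraph (G.Rest h) :=
  G.splice h flip (pairsCrosses_flip hh)

/-- The contraction `G / e`: `e` and its end vertices are replaced by one disc for each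
boundary circle of their union, the circles running along the arcs and the strands of `e` and
keeping the remaining half-ribbons in place.

If `e` is not a self-loop, its ends are merged into one vertex carrying the half-ribbons of both in
the same cyclic order. If `e` is an untwisted self-loop, its vertex is split into two vertices, each
carrying the half-ribbons of one of the two sides of `e`. -/
noncomputable def contract (G : RibbonGraph H) (h : H) (hh : G.pair h ≠ h) :
    RibbonGraph (G.Rest h) :=
  G.splice h G.strand (pairsCrosses_strand hh)

/-! ### Types of edges -/

/-- `e` is a self-loop: both its ends are on the same vertex. -/
def IsLoop (G : RibbonGraph H) (h : H) : Prop := G.vert h = G.vert (G.pair h)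

/-- `e` is a bridge: its removal disconnects a component. -/
def IsBridge (G : RibbonGraph H) (h : H) (hh : G.pair h ≠ h) : Prop :=
  G.numComponents < (G.delete h hh).numComponents

/-- `e` is regular: neither a self-loop nor a bridge. -/
def IsRegular (G : RibbonGraph H) (h : H) (hh : G.pair h ≠ h) : Prop :=
  ¬ G.IsLoop h ∧ ¬ G.IsBridge h hh

/-- Two crosses are on the same side of `e`: one passes from one to the other along
a vertex boundary without passing through the segments of `e`. -/
def SameSide (G : RibbonGraph H) (h : H) : H × Bool → H × Bool → Prop :=
  Relation.EqvGen (fun x y => y = G.arc x ∨ (¬ G.OnEdge h x.1 ∧ y = flip x))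

/-- Two crosses are linked off `e`: one passes from one to the other along vertex boundaries
without passing through the segments of `e`, and along edges other than `e`. -/
def LinkedOff (G : RibbonGraph H) (h : H) : H × Bool → H × Bool → Prop :=
  Relation.EqvGen
    (fun x y => y = G.arc x ∨ (¬ G.OnEdge h x.1 ∧ (y = flip x ∨ y = G.strand x)))

/-- A self-loop is untwisted (its union with its vertex is an annulus): a strand of `e` joins the
two ends of one and the same side. -/
def IsUntwistedLoop (G : RibbonGraph H) (h : H) : Prop :=
  G.IsLoop h ∧ G.SameSide h (h, false) (G.pair h, false)

/-- A self-loop is twisted (its union with its vertex is a Möbius band): a strand of `e` joins ends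
of different sides. -/
def IsTwistedLoop (G : RibbonGraph H) (h : H) : Prop :=
  G.IsLoop h ∧ ¬ G.SameSide h (h, false) (G.pair h, false)

/-- A self-loop is trivial: no cycle is interlaced with it, that is, no path outside its vertex
leads from one of its two sides to the other. -/
def IsTrivialLoop (G : RibbonGraph H) (h : H) : Prop :=
  G.IsLoop h ∧ ¬ G.LinkedOff h (h, false) (h, true)

/-- One of the strands of `e` closes immediately: it is joined at its two ends by a single arc,
so that one of the two sides of the (then untwisted and trivial) self-loop `e`
carries no half-ribbon. -/
def HasInnerFace (G : RibbonGraph H) (h : H) : Prop :=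
  ∃ b, G.arc (h, b) = (G.pair h, b)

end RibbonGraph

/-!
Vertices, connected components, closed faces and components of the boundary graph are all counted
by classes of equivalence relations on the crosses (the ends of the half-ribbons) generated by the
arcs of the vertex boundaries, by the flip between the two crosses of a half-ribbon and by the
strands of the edges. Removing an edge `e` and splicing the arcs at its four crosses along a pairing
`σ` (the strands for `𝒢 / e`, the flip for `𝒢 - e`) replaces, in each of these relations, what the
four crosses contribute by `σ`. So everything depends on how the rest of `𝒢` joins these four
crosses, and this is decided by parity: arcs and flips are involutions without fixed points, hence
every class off `e` meets the crosses of `e` in an even number of points. For a trivial loop the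
crosses `(h, false)` and `(h, true)` lie in different classes, so that each of them is joined to
exactly one cross of the other end of `e`, and being untwisted or twisted says to which.

In the sum over `A ⋐ 𝒢` the `A` without `e` are those of `𝒢 ∨ e`, and the `A` containing `e`
correspond to the spanning c-subgraphs of the spliced graph; both the splicing and the type of `e`
are inherited by them (except for being a bridge, which enters only through `k(𝒢 ∨ e)`).
-/

section Gluing

open Relation

variable {X Y : Type*}

/-- The equivalence relation generated by `x ∼ f x` for `x ∈ S`. -/
def glue (S : Set X) (f : X → X) : Setoid X :=
  EqvGen.setoid fun x y => x ∈ S ∧ y = f x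

/-- The number of equivalence classes of `s`. -/
noncomputable def numClasses (s : Setoid X) : ℕ := Nat.card (Quotient s)

/-- The number of equivalence classes of `s` which do not meet `S`. -/
noncomputable def numClassesAvoiding (s : Setoid X) (S : Set X) : ℕ :=
  (Quotient.mk s '' S)ᶜ.ncard

theorem glue_le_iff {S : Set X} {f : X → X} {s : Setoid X} :
    glue S f ≤ s ↔ ∀ x ∈ S, s x (f x) :=
  ⟨fun hs x hx => hs (EqvGen.rel x (f x) ⟨hx, rfl⟩),
    fun hs => Setoid.eqvGen_le fun x _ ⟨hx, hy⟩ => hy ▸ hs x hx⟩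

theorem glue_rel {S : Set X} {x : X} (f : X → X) (hx : x ∈ S) : glue S f x (f x) :=
  glue_le_iff.1 le_rfl x hx

theorem glue_mono {S T : Set X} (f : X → X) (hST : S ⊆ T) : glue S f ≤ glue T f :=
  glue_le_iff.2 fun _ hx => glue_rel f (hST hx)

theorem glue_congr {S : Set X} {f g : X → X} (hfg : Set.EqOn f g S) : glue S f = glue S g :=
  le_antisymm (glue_le_iff.2 fun _ hx => hfg hx ▸ glue_rel g hx)
    (glue_le_iff.2 fun _ hx => hfg hx ▸ glue_rel f hx)

theorem glue_sup_glue_compl (S : Set X) (f : X → X) : glue S f ⊔ glue Sᶜ f = glue Set.univ f := by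
  refine le_antisymm (sup_le (glue_mono f S.subset_univ) (glue_mono f Sᶜ.subset_univ))
    (glue_le_iff.2 fun x _ => ?_)
  by_cases hx : x ∈ S
  · exact (le_sup_left : glue S f ≤ _) (glue_rel f hx)
  · exact (le_sup_right : glue Sᶜ f ≤ _) (glue_rel f hx)

theorem sup_of_rel_left {s t : Setoid X} {x y : X} (hxy : s x y) : (s ⊔ t) x y :=
  (le_sup_left : s ≤ s ⊔ t) hxy

theorem sup_of_rel_right {s t : Setoid X} {x y : X} (hxy : t x y) : (s ⊔ t) x y :=
  (le_sup_right : t ≤ s ⊔ t) hxy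

theorem comap_sup_glue_range {ι : Y → X} {f : X → X} {g : Y → Y} (hg : ∀ y, ι (g y) = f (ι y))
    (s : Setoid X) :
    Setoid.comap ι (s ⊔ glue (Set.range ι) f) = Setoid.comap ι s ⊔ glue Set.univ g := by
  set t := Setoid.comap ι s ⊔ glue Set.univ g
  -- The classes of `t` to which a point of `X` is joined by `s`; for `ι y` this is only `⟦y⟧`.
  let reached (x : X) : Set (Quotient t) := {q | ∃ y, Quotient.mk t y = q ∧ s x (ι y)}
  have reached_apply (y : Y) : reached (ι y) = {Quotient.mk t y} := by
    ext q
    constructor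
    · rintro ⟨w, rfl, hw⟩
      exact (Quotient.sound (s := t) (sup_of_rel_left hw)).symm
    · rintro rfl
      exact ⟨y, rfl, s.refl' _⟩
  have le_ker : s ⊔ glue (Set.range ι) f ≤ Setoid.ker reached := by
    refine sup_le (fun x x' hx => ?_) (glue_le_iff.2 ?_)
    · ext q
      exact exists_congr fun y => and_congr_right fun _ =>
        ⟨s.trans' (s.symm' hx), s.trans' hx⟩
    · rintro _ ⟨y, rfl⟩
      rw [Setoid.ker_def, ← hg, reached_apply, reached_apply,
        Quotient.sound (s := t) (sup_of_rel_right (glue_rel g (Set.mem_univ y)))]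
  refine le_antisymm (fun y y' hy => ?_) (sup_le (fun _ _ hy => sup_of_rel_left hy)
    (glue_le_iff.2 fun y _ => ?_))
  · have := le_ker hy
    rw [Setoid.ker_def, reached_apply, reached_apply, Set.singleton_eq_singleton_iff] at this
    exact Quotient.exact this
  · rw [Setoid.comap_rel, hg]
    exact sup_of_rel_right (glue_rel f ⟨y, rfl⟩)

theorem eqvGen_setoid_or (r r' : X → X → Prop) :
    EqvGen.setoid (fun x y => r x y ∨ r' x y) = EqvGen.setoid r ⊔ EqvGen.setoid r' :=
  Setoid.gi.gc.l_sup

theorem eqvGen_setoid_eq_glue (f : X → X) :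
    EqvGen.setoid (fun x y => y = f x) = glue Set.univ f := by
  simp only [glue, Set.mem_univ, true_and]

/-- A quotient by an arbitrary relation is a quotient by the generated equivalence relation. -/
def quotEquivQuotient (r : X → X → Prop) : Quot r ≃ Quotient (EqvGen.setoid r) where
  toFun := Quot.map id fun x y hxy => EqvGen.rel x y hxy
  invFun := Quotient.lift (Quot.mk r) fun _ _ hxy => Quot.eqvGen_sound hxy
  left_inv := by rintro ⟨x⟩; rfl
  right_inv := by rintro ⟨x⟩; rfl

theorem numClassesAvoiding_empty (s : Setoid X) : numClassesAvoiding s ∅ = numClasses s := by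
  rw [numClassesAvoiding, Set.image_empty, Set.compl_empty, Set.ncard_univ, numClasses]

theorem numClassesAvoiding_sup_glue {S T : Set X} {f : X → X} (hST : S ⊆ T)
    (hf : Set.MapsTo f S T) (s : Setoid X) :
    numClassesAvoiding (s ⊔ glue S f) T = numClassesAvoiding s T := by
  classical
  set t := s ⊔ glue S f
  let π : Quotient s → Quotient t := Setoid.map_of_le le_sup_left
  -- Only points related by `s` to `T` acquire new partners.
  let classOff (x : X) : Option (Quotient s) :=
    if Quotient.mk s x ∈ Quotient.mk s '' T then none else some (Quotient.mk s x)
  have classOff_of_mem {x : X} (hx : x ∈ T) : classOff x = none :=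
    if_pos (Set.mem_image_of_mem _ hx)
  have le_ker : t ≤ Setoid.ker classOff := by
    refine sup_le (fun x y hxy => ?_) (glue_le_iff.2 fun x hx => ?_)
    · simp only [Setoid.ker_def, classOff, Quotient.sound (s := s) hxy]
    · rw [Setoid.ker_def, classOff_of_mem (hST hx), classOff_of_mem (hf hx)]
  have π_injOn : Set.InjOn π (Quotient.mk s '' T)ᶜ := by
    rintro ⟨x⟩ hx ⟨y⟩ hy hxy
    have : classOff x = classOff y := le_ker (Quotient.exact hxy)
    rw [show classOff x = _ from if_neg hx, show classOff y = _ from if_neg hy] at this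
    exact Option.some_injective _ this
  have π_image : π '' (Quotient.mk s '' T)ᶜ = (Quotient.mk t '' T)ᶜ := by
    ext q
    constructor
    · rintro ⟨⟨x⟩, hx, rfl⟩ ⟨y, hy, hyx⟩
      have : classOff y = classOff x := le_ker (Quotient.exact hyx)
      rw [classOff_of_mem hy, show classOff x = _ from if_neg hx] at this
      exact Option.some_ne_none _ this.symm
    · obtain ⟨x⟩ := q
      refine fun hx => ⟨Quotient.mk s x, ?_, rfl⟩
      rintro ⟨y, hy, hyx⟩
      exact hx ⟨y, hy, Quotient.sound (sup_of_rel_left (Quotient.exact hyx))⟩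
  rw [numClassesAvoiding, ← π_image, π_injOn.ncard_image, numClassesAvoiding]

theorem even_card_of_involution {S : Finset X} {f : X → X} (hS : ∀ x ∈ S, f x ∈ S)
    (hf : ∀ x ∈ S, f (f x) = x) (hne : ∀ x ∈ S, f x ≠ x) : Even S.card := by
  have h : ∑ _x ∈ S, (1 : ZMod 2) = 0 :=
    Finset.sum_involution (fun x _ => f x) (fun _ _ => by decide) (fun x hx _ => hne x hx) hS hf
  rw [Finset.sum_const, nsmul_one] at h
  exact (ZMod.natCast_eq_zero_iff_even).1 h

variable [Finite X]

theorem ncard_image_mk_add_numClassesAvoiding (s : Setoid X) (S : Set X) :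
    (Quotient.mk s '' S).ncard + numClassesAvoiding s S = numClasses s :=
  Set.ncard_add_ncard_compl _

theorem numClasses_le_of_le {s t : Setoid X} (hst : s ≤ t) : numClasses t ≤ numClasses s :=
  Nat.card_le_card_of_surjective (Setoid.map_of_le hst)
    (Quot.ind fun x => ⟨Quotient.mk s x, rfl⟩)

theorem numClassesAvoiding_comap_add {ι : Y → X} {S : Set X} (hS : S ⊆ Set.range ι)
    (s : Setoid X) :
    numClassesAvoiding (Setoid.comap ι s) (ι ⁻¹' S) + numClassesAvoiding s (Set.range ι) =
      numClassesAvoiding s S := by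
  let φ : Quotient (Setoid.comap ι s) → Quotient s := Quotient.map ι fun _ _ hy => hy
  have φ_injective : Function.Injective φ := by
    rintro ⟨y⟩ ⟨y'⟩ hy
    exact Quotient.sound (Quotient.exact hy : s (ι y) (ι y'))
  have φ_image (T : Set Y) : φ '' (Quotient.mk _ '' T) = Quotient.mk s '' (ι '' T) := by
    simp only [Set.image_image, φ, Quotient.map_mk]
  have φ_range : Set.range φ = Quotient.mk s '' Set.range ι := by
    have := φ_image Set.univ
    rwa [Set.image_univ_of_surjective Quotient.mk_surjective, Set.image_univ,
      Set.image_univ] at this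
  have image_compl : φ '' (Quotient.mk _ '' (ι ⁻¹' S))ᶜ =
      Quotient.mk s '' Set.range ι \ Quotient.mk s '' S := by
    rw [Set.image_compl_eq_range_sdiff_image φ_injective, φ_image, φ_range,
      Set.image_preimage_eq_of_subset hS]
  rw [numClassesAvoiding, ← Set.ncard_image_of_injective _ φ_injective, image_compl,
    numClassesAvoiding, numClassesAvoiding, ← Set.ncard_union_eq]
  · congr 1
    ext q
    have : q ∈ Quotient.mk s '' S → q ∈ Quotient.mk s '' Set.range ι :=
      fun hq => Set.image_mono hS hq
    simp only [Set.mem_union, Set.mem_sdiff, Set.mem_compl_iff]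
    tauto
  · exact disjoint_compl_right.mono_left Set.sdiff_subset

theorem numClasses_eq_add_one {s : Setoid X} {a b : X} (hab : ¬ s a b) :
    numClasses s = numClasses (s ⊔ glue {a} fun _ => b) + 1 := by
  have hs := ncard_image_mk_add_numClassesAvoiding s {a, b}
  have ht := ncard_image_mk_add_numClassesAvoiding (s ⊔ glue {a} fun _ => b) {a, b}
  have hne : Quotient.mk s a ≠ Quotient.mk s b := fun h => hab (Quotient.exact h)
  have heq : Quotient.mk (s ⊔ glue {a} fun _ => b) a = Quotient.mk _ b :=
    Quotient.sound (sup_of_rel_right (glue_rel (fun _ => b) rfl))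
  rw [Set.image_pair, Set.ncard_pair hne] at hs
  rw [Set.image_pair, heq, Set.pair_eq_singleton, Set.ncard_singleton,
    numClassesAvoiding_sup_glue (by simp) (by simp [Set.MapsTo])] at ht
  omega

theorem numClasses_le_add_one (s : Setoid X) (a b : X) :
    numClasses s ≤ numClasses (s ⊔ glue {a} fun _ => b) + 1 := by
  by_cases hab : s a b
  · rw [sup_eq_left.2 (glue_le_iff.2 fun x hx => hx ▸ hab)]
    exact Nat.le_succ _
  · exact (numClasses_eq_add_one hab).le

theorem exists_ne_sup_glue {f g : X → X} {S : Set X} (hf : Function.Involutive f)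
    (hf_ne : ∀ x, f x ≠ x) (hg : ∀ x ∉ S, g (g x) = x) (hg_ne : ∀ x ∉ S, g x ≠ x)
    (hg_mem : ∀ x ∉ S, g x ∉ S) {x : X} (hx : x ∈ S) :
    ∃ y ∈ S, y ≠ x ∧ (glue Set.univ f ⊔ glue Sᶜ g) x y := by
  classical
  have := Fintype.ofFinite X
  by_contra! alone
  set s := glue Set.univ f ⊔ glue Sᶜ g
  -- `f` acts freely on the class of `x`, and `g` on the class of `x` without `x`.
  let K : Finset X := {y | s x y}
  have mem_K {y : X} : y ∈ K ↔ s x y := by simp [K]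
  have hxK : x ∈ K := mem_K.2 (s.refl' x)
  have even_K : Even K.card := even_card_of_involution
    (fun y hy => mem_K.2 (s.trans' (mem_K.1 hy) (sup_of_rel_left (glue_rel f (Set.mem_univ y)))))
    (fun y _ => hf y) (fun y _ => hf_ne y)
  have off {y : X} (hy : y ∈ K.erase x) : y ∉ S := fun hyS =>
    alone y hyS (Finset.ne_of_mem_erase hy) (mem_K.1 (Finset.mem_of_mem_erase hy))
  have even_erase : Even (K.erase x).card := even_card_of_involution
    (fun y hy => Finset.mem_erase.2 ⟨fun h => hg_mem y (off hy) (by rwa [h]), mem_K.2 (s.trans'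
      (mem_K.1 (Finset.mem_of_mem_erase hy)) (sup_of_rel_right (glue_rel g (off hy))))⟩)
    (fun y hy => hg y (off hy)) (fun y hy => hg_ne y (off hy))
  rw [← Finset.card_erase_add_one hxK] at even_K
  exact Nat.even_add_one.1 even_K even_erase

end Gluing

namespace RibbonGraph

section Setoids

variable {H : Type*} (G : RibbonGraph H)

/-- The four crosses of the edge of `h`. -/
def edgeCrosses (h : H) : Set (H × Bool) := {x | G.OnEdge h x.1}

/-- The external points of the flags. -/
def flagCrosses : Set (H × Bool) := {x | G.IsFlag x.1}

/-- Crosses joined by an arc of a vertex boundary. -/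
def arcSetoid : Setoid (H × Bool) := glue Set.univ G.arc

/-- Crosses on the same vertex. -/
def vertexSetoid : Setoid (H × Bool) := G.arcSetoid ⊔ glue Set.univ flip

/-- Crosses in the same connected component. -/
def componentSetoid : Setoid (H × Bool) := G.vertexSetoid ⊔ glue Set.univ G.strand

/-- Crosses on the same face. -/
def faceSetoid : Setoid (H × Bool) := G.arcSetoid ⊔ glue Set.univ G.strand

open Classical in
/-- Continue along the boundary of the ribbon graph from the end `x` of an arc, running over the
free segment of a flag; contrary to `strand`, this involution has no fixed points. -/
noncomputable def jump (x : H × Bool) : H × Bool := if G.IsFlag x.1 then flip x else G.strand x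

/-- Crosses on the same boundary circle of the ribbon graph as a surface, where the free segments
of the flags belong to the boundary. -/
noncomputable def boundarySetoid : Setoid (H × Bool) := G.arcSetoid ⊔ glue Set.univ G.jump

theorem jump_of_isFlag {x : H × Bool} (hx : G.IsFlag x.1) : G.jump x = flip x := if_pos hx

theorem jump_of_not_isFlag {x : H × Bool} (hx : ¬ G.IsFlag x.1) : G.jump x = G.strand x :=
  if_neg hx

theorem strand_of_isFlag {x : H × Bool} (hx : G.IsFlag x.1) : G.strand x = x :=
  Prod.ext hx rfl

theorem boundarySetoid_eq : G.boundarySetoid = G.faceSetoid ⊔ glue G.flagCrosses flip := by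
  refine le_antisymm (sup_le (le_sup_left.trans le_sup_left) ?_)
    (sup_le (sup_le le_sup_left ?_) ?_) <;> refine glue_le_iff.2 fun x hx => ?_
  · by_cases hf : G.IsFlag x.1
    · exact G.jump_of_isFlag hf ▸ sup_of_rel_right (glue_rel flip hf)
    · exact G.jump_of_not_isFlag hf ▸ sup_of_rel_left (sup_of_rel_right (glue_rel G.strand hx))
  · by_cases hf : G.IsFlag x.1
    · exact (G.strand_of_isFlag hf).symm ▸ Setoid.refl' _ x
    · exact G.jump_of_not_isFlag hf ▸ sup_of_rel_right (glue_rel G.jump hx)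
  · exact G.jump_of_isFlag hx ▸ sup_of_rel_right (glue_rel G.jump (Set.mem_univ x))

theorem eqvGen_setoid_face :
    Relation.EqvGen.setoid (fun x y => y = G.arc x ∨ y = G.strand x) = G.faceSetoid := by
  rw [eqvGen_setoid_or, eqvGen_setoid_eq_glue, eqvGen_setoid_eq_glue, faceSetoid, arcSetoid]

theorem eqvGen_setoid_vertex :
    Relation.EqvGen.setoid (fun x y => y = G.arc x ∨ y = flip x) = G.vertexSetoid := by
  rw [eqvGen_setoid_or, eqvGen_setoid_eq_glue, eqvGen_setoid_eq_glue, vertexSetoid, arcSetoid]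

theorem face_eq_iff {x y : H × Bool} : G.face x = G.face y ↔ G.faceSetoid x y := by
  rw [← eqvGen_setoid_face]
  exact Quot.eq

theorem rel_of_glue_flip_le {s : Setoid (H × Bool)} (hs : glue Set.univ flip ≤ s) (x : H)
    (b c : Bool) : s (x, b) (x, c) := by
  have h : s (x, false) (x, true) := glue_le_iff.1 hs (x, false) (Set.mem_univ _)
  cases b <;> cases c
  exacts [s.refl' _, h, s.symm' h, s.refl' _]

theorem range_prodMap_id {R : Type*} (ι : R → H) :
    Set.range (Prod.map ι (id : Bool → Bool)) = {x | x.1 ∈ Set.range ι} := by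
  ext x
  simp

theorem inl_mk_eq_vert (x : H × Bool) : (Sum.inl (Quot.mk _ x) : G.Vertex) = G.vert x.1 := by
  obtain ⟨x, _ | _⟩ := x
  · rfl
  · exact congrArg Sum.inl (Quot.sound (Or.inr rfl))

theorem numClosedFaces_eq :
    G.numClosedFaces = numClassesAvoiding G.boundarySetoid G.flagCrosses + G.isolated := by
  rw [boundarySetoid_eq, numClassesAvoiding_sup_glue subset_rfl (f := flip) (fun _ hx => hx),
    numClosedFaces, numClassesAvoiding, ← Nat.card_coe_set_eq, ← eqvGen_setoid_face]
  congr 1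
  refine Nat.card_congr ((quotEquivQuotient _).subtypeEquiv ?_)
  rintro ⟨x⟩
  exact not_congr (exists_congr fun y => and_congr_right fun _ =>
    (quotEquivQuotient _).apply_eq_iff_eq.symm)

variable [Finite H]

theorem numVertices_eq : G.numVertices = numClasses G.vertexSetoid + G.isolated := by
  rw [numVertices, Vertex, Nat.card_sum, Nat.card_fin, Nat.card_congr (quotEquivQuotient _),
    eqvGen_setoid_vertex, numClasses]

theorem numComponents_eq : G.numComponents = numClasses G.componentSetoid + G.isolated := by
  have rel_le {x y : H × Bool} (hxy : y = G.arc x ∨ y = flip x) : G.componentSetoid x y := by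
    obtain rfl | rfl := hxy
    · exact sup_of_rel_left (sup_of_rel_left (glue_rel G.arc (Set.mem_univ x)))
    · exact sup_of_rel_left (sup_of_rel_right (glue_rel flip (Set.mem_univ x)))
  let toComponent (x : H × Bool) : G.Component := Quot.mk _ (Sum.inl (Quot.mk _ x))
  have le_ker : G.componentSetoid ≤ Setoid.ker toComponent := by
    refine sup_le (sup_le ?_ ?_) ?_ <;> refine glue_le_iff.2 fun x _ => ?_
    · exact congrArg (Quot.mk _ ∘ Sum.inl) (Quot.sound (Or.inl rfl))
    · exact congrArg (Quot.mk _ ∘ Sum.inl) (Quot.sound (Or.inr rfl))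
    · exact Quot.sound ⟨x.1, G.inl_mk_eq_vert x, G.inl_mk_eq_vert (G.strand x)⟩
  have e : G.Component ≃ Quotient G.componentSetoid ⊕ Fin G.isolated :=
    { toFun := Quot.lift
        (Sum.map (Quot.lift (Quotient.mk _) fun _ _ hxy => Quotient.sound (rel_le hxy)) id) (by
          rintro _ _ ⟨h, rfl, rfl⟩
          exact congrArg Sum.inl
            (Quotient.sound (sup_of_rel_right (glue_rel G.strand (Set.mem_univ _)))))
      invFun := Sum.elim (Quotient.lift toComponent fun _ _ hxy => le_ker hxy)
        fun i => Quot.mk _ (Sum.inr i)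
      left_inv := by rintro ⟨⟨⟨x⟩⟩ | i⟩ <;> rfl
      right_inv := by rintro (⟨⟨x⟩⟩ | i) <;> rfl }
  rw [numComponents, Nat.card_congr e, Nat.card_sum, Nat.card_fin, numClasses]

theorem numBoundaryComponents_add :
    G.numBoundaryComponents + numClassesAvoiding G.boundarySetoid G.flagCrosses =
      numClasses G.boundarySetoid := by
  let ι : {h // G.IsFlag h} × Bool → H × Bool := Prod.map Subtype.val id
  have range_ι : Set.range ι = G.flagCrosses := by
    ext x
    simp [ι, flagCrosses]
  let s := Setoid.comap ι G.faceSetoid ⊔ glue Set.univ flip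
  have comap_eq : Setoid.comap ι G.boundarySetoid = s := by
    rw [boundarySetoid_eq, ← range_ι, comap_sup_glue_range fun x => (rfl : ι (flip x) = flip (ι x))]
  have le_ker : s ≤ Setoid.ker fun x => (Quot.mk _ x.1 : G.BoundaryComponent) :=
    sup_le (fun x y hxy => Quot.sound ⟨_, ⟨x.2, rfl⟩, y.2, (G.face_eq_iff.2 hxy).symm⟩)
      (glue_le_iff.2 fun _ _ => rfl)
  have e : G.BoundaryComponent ≃ Quotient s :=
    { toFun := Quot.lift (fun g => Quotient.mk s (g, false)) (by
        rintro g g' ⟨_, ⟨b, rfl⟩, c, hc⟩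
        have hface : s (g, b) (g', c) := sup_of_rel_left (G.face_eq_iff.1 hc.symm)
        exact Quotient.sound (s.trans' (s.trans' (rel_of_glue_flip_le le_sup_right g false b) hface)
          (rel_of_glue_flip_le le_sup_right g' c false)))
      invFun := Quotient.lift (fun x => Quot.mk _ x.1) fun _ _ hxy => le_ker hxy
      left_inv := by rintro ⟨g⟩; rfl
      right_inv := by
        rintro ⟨g, b⟩
        exact Quotient.sound (rel_of_glue_flip_le le_sup_right g false b) }
  rw [← numClassesAvoiding_empty, ← numClassesAvoiding_comap_add (Set.empty_subset (Set.range ι)),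
    Set.preimage_empty, numClassesAvoiding_empty, range_ι, comap_eq, numClasses,
    ← Nat.card_congr e, numBoundaryComponents]

end Setoids

section Splice

variable {H R : Type*} {G : RibbonGraph H} {h : H} {σ : H × Bool → H × Bool}
  {L : RibbonGraph R} {ι : R → H}

/-- `L`, whose half-ribbons are embedded by `ι` into those of `G`, arises from `G` by removing the
edge of `h` and reconnecting the arcs ending at its crosses by means of `σ`. The arcs of `L` are
described only up to the equivalence relation which they generate; this suffices for counting. -/
structure IsSplice (G : RibbonGraph H) (h : H) (σ : H × Bool → H × Bool) (L : RibbonGraph R)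
    (ι : R → H) : Prop where
  injective : Function.Injective ι
  mem_range_iff : ∀ x, x ∈ Set.range ι ↔ ¬ G.OnEdge h x
  pair_eq : ∀ x, ι (L.pair x) = G.pair (ι x)
  comap_eq : Setoid.comap (Prod.map ι id) (G.arcSetoid ⊔ glue (G.edgeCrosses h) σ) = L.arcSetoid
  isolated_eq : L.isolated = G.isolated +
    numClassesAvoiding (G.arcSetoid ⊔ glue (G.edgeCrosses h) σ) (G.edgeCrosses h)ᶜ

namespace IsSplice

theorem range_prodMap (hL : G.IsSplice h σ L ι) :
    Set.range (Prod.map ι (id : Bool → Bool)) = (G.edgeCrosses h)ᶜ := by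
  ext x
  rw [range_prodMap_id]
  exact hL.mem_range_iff x.1

theorem strand_eq (hL : G.IsSplice h σ L ι) (x : R × Bool) :
    Prod.map ι id (L.strand x) = G.strand (Prod.map ι id x) :=
  Prod.ext (hL.pair_eq x.1) rfl

theorem isFlag_iff (hL : G.IsSplice h σ L ι) {x : R} : L.IsFlag x ↔ G.IsFlag (ι x) := by
  rw [IsFlag, IsFlag, ← hL.pair_eq, hL.injective.eq_iff]

theorem jump_eq (hL : G.IsSplice h σ L ι) (x : R × Bool) :
    Prod.map ι id (L.jump x) = G.jump (Prod.map ι id x) := by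
  by_cases hx : L.IsFlag x.1
  · rw [jump_of_isFlag _ hx, jump_of_isFlag _ (hL.isFlag_iff.1 hx)]
    rfl
  · rw [jump_of_not_isFlag _ hx, jump_of_not_isFlag _ (mt hL.isFlag_iff.2 hx), hL.strand_eq]

theorem comap_sup_glue (hL : G.IsSplice h σ L ι) {f : H × Bool → H × Bool}
    {g : R × Bool → R × Bool} (hg : ∀ x, Prod.map ι id (g x) = f (Prod.map ι id x)) (s) :
    Setoid.comap (Prod.map ι id) (s ⊔ glue (G.edgeCrosses h)ᶜ f) =
      Setoid.comap (Prod.map ι id) s ⊔ glue Set.univ g := by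
  rw [← hL.range_prodMap, comap_sup_glue_range hg]

theorem congr (hL : G.IsSplice h σ L ι) {τ : H × Bool → H × Bool}
    (hστ : Set.EqOn σ τ (G.edgeCrosses h)) : G.IsSplice h τ L ι where
  __ := hL
  comap_eq := by rw [← glue_congr hστ, hL.comap_eq]
  isolated_eq := by rw [← glue_congr hστ, hL.isolated_eq]

end IsSplice

variable [DecidableEq H]

theorem rel_spliceArc (x : H × Bool) :
    (G.arcSetoid ⊔ glue (G.edgeCrosses h) σ) x (G.spliceArc h σ x) := by
  set s := G.arcSetoid ⊔ glue (G.edgeCrosses h) σ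
  have rel_arc (y : H × Bool) : s y (G.arc y) := sup_of_rel_left (glue_rel G.arc (Set.mem_univ y))
  have rel_step (y : H × Bool) : s y (G.spliceStep h σ y) := by
    by_cases hy : G.OnEdge h y.1
    · rw [spliceStep_on hy]
      exact s.trans' (sup_of_rel_right (glue_rel σ hy)) (rel_arc (σ y))
    · rw [spliceStep_off hy]
  exact s.trans' (s.trans' (rel_arc x) (rel_step _)) (rel_step _)

theorem eq_or_eq_spliceArc_of_rel (P : G.PairsCrosses h σ) {x y : H × Bool}
    (hx : ¬ G.OnEdge h x.1) (hy : ¬ G.OnEdge h y.1)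
    (hxy : (G.arcSetoid ⊔ glue (G.edgeCrosses h) σ) x y) : y = x ∨ y = G.spliceArc h σ x := by
  let u (k : ℕ) : H × Bool := (G.spliceStep h σ)^[k] (G.arc x)
  have u_succ (k : ℕ) : u (k + 1) = G.spliceStep h σ (u k) := Function.iterate_succ_apply' _ _ _
  -- The crosses on the curve which leaves `x` along its arc.
  let S : Set (H × Bool) := {z | z = x ∨ ∃ k, z = u k ∨ G.OnEdge h (u k).1 ∧ z = σ (u k)}
  have arc_u_mem (k : ℕ) : G.arc (u k) ∈ S := by
    induction k with
    | zero => exact Or.inl (G.arc_arc x)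
    | succ k ih =>
      rw [u_succ]
      by_cases hk : G.OnEdge h (u k).1
      · rw [spliceStep_on hk, G.arc_arc]
        exact Or.inr ⟨k, Or.inr ⟨hk, rfl⟩⟩
      · rwa [spliceStep_off hk]
  have arc_mem {z : H × Bool} (hz : z ∈ S) : G.arc z ∈ S := by
    obtain rfl | ⟨k, rfl | ⟨hk, rfl⟩⟩ := hz
    · exact Or.inr ⟨0, Or.inl rfl⟩
    · exact arc_u_mem k
    · exact Or.inr ⟨k + 1, Or.inl (by rw [u_succ, spliceStep_on hk])⟩
  have σ_mem {z : H × Bool} (hz : z ∈ S) (hzh : G.OnEdge h z.1) : σ z ∈ S := by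
    obtain rfl | ⟨k, rfl | ⟨hk, rfl⟩⟩ := hz
    · exact absurd hzh hx
    · exact Or.inr ⟨k, Or.inr ⟨hzh, rfl⟩⟩
    · exact Or.inr ⟨k, Or.inl (P.invol _ hk)⟩
  have le_ker : G.arcSetoid ⊔ glue (G.edgeCrosses h) σ ≤ Setoid.ker (· ∈ S) :=
    sup_le (glue_le_iff.2 fun z _ => propext ⟨arc_mem, fun hz => G.arc_arc z ▸ arc_mem hz⟩)
      (glue_le_iff.2 fun z hz => propext ⟨fun hzS => σ_mem hzS hz,
        fun hzS => P.invol z hz ▸ σ_mem hzS (P.on z hz)⟩)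
  have fixed {z : H × Bool} (hz : ¬ G.OnEdge h z.1) (k : ℕ) : (G.spliceStep h σ)^[k] z = z :=
    Function.iterate_fixed (spliceStep_off hz) k
  obtain rfl | ⟨k, rfl | ⟨hk, rfl⟩⟩ : y ∈ S := (le_ker hxy).mp (Or.inl rfl)
  · exact Or.inl rfl
  · have hux : (G.spliceStep h σ)^[k] (G.spliceArc h σ x) = (G.spliceStep h σ)^[2] (u k) :=
      Function.Commute.iterate_iterate_self _ k 2 (G.arc x)
    rw [fixed (spliceArc_spec P hx).1, fixed hy] at hux
    exact Or.inr hux.symm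
  · exact absurd (P.on _ hk) hy

theorem isSplice_splice (P : G.PairsCrosses h σ) :
    G.IsSplice h σ (G.splice h σ P) Subtype.val where
  injective := Subtype.val_injective
  mem_range_iff _ := ⟨by rintro ⟨y, rfl⟩; exact not_onEdge y, fun hx => ⟨⟨_, not_or.1 hx⟩, rfl⟩⟩
  pair_eq _ := rfl
  comap_eq := by
    have injective := (Subtype.val_injective (p := fun x => x ≠ h ∧ x ≠ G.pair h)).prodMap
      (Function.injective_id (α := Bool))
    refine le_antisymm (fun x y hxy => ?_) (glue_le_iff.2 fun x _ => rel_spliceArc _)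
    obtain hyx | hyx := eq_or_eq_spliceArc_of_rel P (not_onEdge x.1) (not_onEdge y.1) hxy
    · obtain rfl : y = x := injective hyx
      exact Setoid.refl' _ _
    · obtain rfl : y = (G.splice h σ P).arc x := injective hyx
      exact glue_rel _ (Set.mem_univ x)
  isolated_eq := by
    rw [arcSetoid, ← eqvGen_setoid_eq_glue, glue, ← eqvGen_setoid_or, numClassesAvoiding,
      ← Nat.card_coe_set_eq]
    refine congrArg (G.isolated + ·) (Nat.card_congr ((quotEquivQuotient _).subtypeEquiv ?_))
    rintro ⟨x⟩
    refine ⟨?_, ?_⟩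
    · rintro hx ⟨y, hy, hyx⟩
      exact hy (hx y ((quotEquivQuotient _).injective hyx))
    · exact fun hx y hyx => not_not.1 fun hy => hx ⟨y, hy, congrArg (quotEquivQuotient _) hyx⟩

end Splice

section Counts

variable {H : Type*} {G : RibbonGraph H} {h : H}

theorem onEdge_pair_iff {x : H} : G.OnEdge h (G.pair x) ↔ G.OnEdge h x := by
  have onEdge_pair {y : H} : G.OnEdge h y → G.OnEdge h (G.pair y) := by
    rintro (rfl | rfl)
    exacts [Or.inr rfl, Or.inl (G.pair_pair h)]
  exact ⟨fun hx => G.pair_pair x ▸ onEdge_pair hx, onEdge_pair⟩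

theorem not_isFlag_of_onEdge (hh : G.pair h ≠ h) {x : H} (hx : G.OnEdge h x) : ¬ G.IsFlag x := by
  obtain rfl | rfl := hx
  · exact hh
  · rw [IsFlag, G.pair_pair]
    exact hh.symm

theorem mapsTo_flip_compl : Set.MapsTo flip (G.edgeCrosses h)ᶜ (G.edgeCrosses h)ᶜ :=
  fun _ hx => hx

theorem mapsTo_strand_compl : Set.MapsTo G.strand (G.edgeCrosses h)ᶜ (G.edgeCrosses h)ᶜ :=
  fun _ hx => mt onEdge_pair_iff.1 hx

theorem mapsTo_jump_compl : Set.MapsTo G.jump (G.edgeCrosses h)ᶜ (G.edgeCrosses h)ᶜ := by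
  intro x hx
  by_cases hf : G.IsFlag x.1
  · rwa [jump_of_isFlag _ hf]
  · rw [jump_of_not_isFlag _ hf]
    exact mapsTo_strand_compl hx

variable (G h)

/-- Crosses on the same side of the edge of `h`, as in `SameSide`. -/
def sideSetoid : Setoid (H × Bool) := G.arcSetoid ⊔ glue (G.edgeCrosses h)ᶜ flip

/-- Crosses linked off the edge of `h`, as in `LinkedOff`. -/
def linkSetoid : Setoid (H × Bool) := G.sideSetoid h ⊔ glue (G.edgeCrosses h)ᶜ G.strand

/-- Crosses on the same piece of the boundary of the ribbon graph, the strands of the edge of `h`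
being removed from the boundary. -/
noncomputable def rimSetoid : Setoid (H × Bool) := G.arcSetoid ⊔ glue (G.edgeCrosses h)ᶜ G.jump

theorem sideSetoid_sup_glue_flip :
    G.sideSetoid h ⊔ glue (G.edgeCrosses h) flip = G.vertexSetoid := by
  rw [sideSetoid, sup_assoc, sup_comm (glue _ _), glue_sup_glue_compl, vertexSetoid]

theorem linkSetoid_sup_glue :
    G.linkSetoid h ⊔ glue (G.edgeCrosses h) flip ⊔ glue (G.edgeCrosses h) G.strand =
      G.componentSetoid := by
  rw [linkSetoid, sup_right_comm _ _ (glue _ flip), sideSetoid_sup_glue_flip, sup_assoc,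
    sup_comm (glue _ _), glue_sup_glue_compl, componentSetoid]

theorem eqOn_strand_jump (hh : G.pair h ≠ h) : Set.EqOn G.strand G.jump (G.edgeCrosses h) :=
  fun _ hx => (jump_of_not_isFlag G (not_isFlag_of_onEdge hh hx)).symm

theorem rimSetoid_sup_glue_strand (hh : G.pair h ≠ h) :
    G.rimSetoid h ⊔ glue (G.edgeCrosses h) G.strand = G.boundarySetoid := by
  rw [glue_congr (G.eqOn_strand_jump h hh), rimSetoid, sup_assoc, sup_comm (glue _ _),
    glue_sup_glue_compl, boundarySetoid]

theorem sideSetoid_le_linkSetoid : G.sideSetoid h ≤ G.linkSetoid h := le_sup_left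

theorem rimSetoid_le_linkSetoid : G.rimSetoid h ≤ G.linkSetoid h := by
  refine sup_le (le_sup_left.trans (sideSetoid_le_linkSetoid G h)) (glue_le_iff.2 fun x hx => ?_)
  by_cases hf : G.IsFlag x.1
  · rw [jump_of_isFlag _ hf]
    exact sup_of_rel_left (sup_of_rel_right (glue_rel flip hx))
  · rw [jump_of_not_isFlag _ hf]
    exact sup_of_rel_right (glue_rel G.strand hx)

variable {G h}

namespace IsSplice

variable {R : Type*} {L : RibbonGraph R} {ι : R → H} {σ : H × Bool → H × Bool}

theorem vertexSetoid_eq (hL : G.IsSplice h σ L ι) : L.vertexSetoid =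
    Setoid.comap (Prod.map ι id) (G.sideSetoid h ⊔ glue (G.edgeCrosses h) σ) := by
  rw [sideSetoid, sup_right_comm, hL.comap_sup_glue (g := flip) fun _ => rfl, hL.comap_eq,
    vertexSetoid]

theorem componentSetoid_eq (hL : G.IsSplice h σ L ι) : L.componentSetoid =
    Setoid.comap (Prod.map ι id) (G.linkSetoid h ⊔ glue (G.edgeCrosses h) σ) := by
  rw [linkSetoid, sup_right_comm, hL.comap_sup_glue hL.strand_eq, ← hL.vertexSetoid_eq,
    componentSetoid]

theorem boundarySetoid_eq (hL : G.IsSplice h σ L ι) : L.boundarySetoid =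
    Setoid.comap (Prod.map ι id) (G.rimSetoid h ⊔ glue (G.edgeCrosses h) σ) := by
  rw [rimSetoid, sup_right_comm, hL.comap_sup_glue hL.jump_eq, hL.comap_eq, boundarySetoid]

theorem preimage_flagCrosses (hL : G.IsSplice h σ L ι) :
    Prod.map ι id ⁻¹' G.flagCrosses = L.flagCrosses :=
  Set.ext fun _ => hL.isFlag_iff.symm

theorem numFlags_eq (hL : G.IsSplice h σ L ι) (hh : G.pair h ≠ h) : L.numFlags = G.numFlags := by
  refine Nat.card_congr (Equiv.ofBijective (fun x => ⟨ι x, hL.isFlag_iff.1 x.2⟩) ⟨?_, ?_⟩)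
  · exact fun x y hxy => Subtype.ext (hL.injective (congrArg Subtype.val hxy))
  · rintro ⟨x, hx⟩
    obtain ⟨y, rfl⟩ := (hL.mem_range_iff x).2 fun hxh => not_isFlag_of_onEdge hh hxh hx
    exact ⟨⟨y, hL.isFlag_iff.2 hx⟩, rfl⟩

variable [Finite H]

theorem numClassesAvoiding_add_isolated (hL : G.IsSplice h σ L ι) {t : Setoid (H × Bool)}
    (ht : numClassesAvoiding t (G.edgeCrosses h)ᶜ =
      numClassesAvoiding (G.arcSetoid ⊔ glue (G.edgeCrosses h) σ) (G.edgeCrosses h)ᶜ)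
    {S : Set (H × Bool)} (hS : S ⊆ (G.edgeCrosses h)ᶜ) :
    numClassesAvoiding (Setoid.comap (Prod.map ι id) t) (Prod.map ι id ⁻¹' S) + L.isolated =
      numClassesAvoiding t S + G.isolated := by
  have := numClassesAvoiding_comap_add (hL.range_prodMap ▸ hS) t
  rw [hL.range_prodMap, ht] at this
  rw [hL.isolated_eq]
  omega

theorem numClasses_add_isolated (hL : G.IsSplice h σ L ι) {t : Setoid (H × Bool)}
    (ht : numClassesAvoiding t (G.edgeCrosses h)ᶜ =
      numClassesAvoiding (G.arcSetoid ⊔ glue (G.edgeCrosses h) σ) (G.edgeCrosses h)ᶜ) :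
    numClasses (Setoid.comap (Prod.map ι id) t) + L.isolated = numClasses t + G.isolated := by
  simpa only [Set.preimage_empty, numClassesAvoiding_empty] using
    hL.numClassesAvoiding_add_isolated ht (Set.empty_subset _)

theorem numVertices_eq (hL : G.IsSplice h σ L ι) :
    L.numVertices = numClasses (G.sideSetoid h ⊔ glue (G.edgeCrosses h) σ) + G.isolated := by
  have := Finite.of_injective ι hL.injective
  rw [RibbonGraph.numVertices_eq, hL.vertexSetoid_eq]
  refine hL.numClasses_add_isolated ?_
  rw [sideSetoid, sup_right_comm, numClassesAvoiding_sup_glue subset_rfl mapsTo_flip_compl]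

theorem numComponents_eq (hL : G.IsSplice h σ L ι) :
    L.numComponents = numClasses (G.linkSetoid h ⊔ glue (G.edgeCrosses h) σ) + G.isolated := by
  have := Finite.of_injective ι hL.injective
  rw [RibbonGraph.numComponents_eq, hL.componentSetoid_eq]
  refine hL.numClasses_add_isolated ?_
  rw [linkSetoid, sideSetoid, sup_right_comm, sup_right_comm _ _ (glue _ σ),
    numClassesAvoiding_sup_glue subset_rfl mapsTo_strand_compl,
    numClassesAvoiding_sup_glue subset_rfl mapsTo_flip_compl]

theorem numClassesAvoiding_boundarySetoid_add_isolated (hL : G.IsSplice h σ L ι)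
    (heq : G.rimSetoid h ⊔ glue (G.edgeCrosses h) σ = G.boundarySetoid) {S : Set (H × Bool)}
    (hS : S ⊆ (G.edgeCrosses h)ᶜ) :
    numClassesAvoiding L.boundarySetoid (Prod.map ι id ⁻¹' S) + L.isolated =
      numClassesAvoiding G.boundarySetoid S + G.isolated := by
  rw [hL.boundarySetoid_eq, heq]
  refine hL.numClassesAvoiding_add_isolated ?_ hS
  rw [← heq, rimSetoid, sup_right_comm, numClassesAvoiding_sup_glue subset_rfl mapsTo_jump_compl]

theorem numClosedFaces_eq (hL : G.IsSplice h σ L ι) (hh : G.pair h ≠ h)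
    (heq : G.rimSetoid h ⊔ glue (G.edgeCrosses h) σ = G.boundarySetoid) :
    L.numClosedFaces = G.numClosedFaces := by
  have flagCrosses_subset : G.flagCrosses ⊆ (G.edgeCrosses h)ᶜ :=
    fun _ hx hxh => not_isFlag_of_onEdge hh hxh hx
  rw [RibbonGraph.numClosedFaces_eq, RibbonGraph.numClosedFaces_eq, ← hL.preimage_flagCrosses,
    hL.numClassesAvoiding_boundarySetoid_add_isolated heq flagCrosses_subset]

theorem numBoundaryComponents_eq (hL : G.IsSplice h σ L ι) (hh : G.pair h ≠ h)
    (heq : G.rimSetoid h ⊔ glue (G.edgeCrosses h) σ = G.boundarySetoid) :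
    L.numBoundaryComponents = G.numBoundaryComponents := by
  have := Finite.of_injective ι hL.injective
  have faces := hL.numClosedFaces_eq hh heq
  have classes := hL.numClassesAvoiding_boundarySetoid_add_isolated heq (Set.empty_subset _)
  rw [RibbonGraph.numClosedFaces_eq, RibbonGraph.numClosedFaces_eq] at faces
  rw [Set.preimage_empty, numClassesAvoiding_empty, numClassesAvoiding_empty,
    ← numBoundaryComponents_add, ← numBoundaryComponents_add] at classes
  omega

end IsSplice

end Counts

section EdgeTypes

variable {H : Type*} {G : RibbonGraph H} {h : H}

theorem sameSide_iff {x y : H × Bool} : G.SameSide h x y ↔ G.sideSetoid h x y := by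
  rw [sideSetoid, arcSetoid, ← eqvGen_setoid_eq_glue, glue, ← eqvGen_setoid_or]
  rfl

theorem linkedOff_iff {x y : H × Bool} : G.LinkedOff h x y ↔ G.linkSetoid h x y := by
  rw [linkSetoid, sideSetoid, arcSetoid, ← eqvGen_setoid_eq_glue, glue, glue, sup_assoc,
    ← eqvGen_setoid_or, ← eqvGen_setoid_or]
  simp only [LinkedOff, and_or_left]
  rfl

theorem isLoop_iff : G.IsLoop h ↔ G.vertexSetoid (h, false) (G.pair h, false) := by
  rw [← eqvGen_setoid_vertex]
  exact Sum.inl_injective.eq_iff.trans Quot.eq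

theorem glue_strand_le_iff {s : Setoid (H × Bool)} :
    glue (G.edgeCrosses h) G.strand ≤ s ↔ ∀ b, s (h, b) (G.pair h, b) := by
  refine glue_le_iff.trans ⟨fun hs b => hs (h, b) (Or.inl rfl), ?_⟩
  rintro hs ⟨x, b⟩ (rfl | rfl)
  · exact hs b
  · rw [strand, G.pair_pair]
    exact s.symm' (hs b)

theorem glue_flip_le_iff {s : Setoid (H × Bool)} : glue (G.edgeCrosses h) flip ≤ s ↔
    s (h, false) (h, true) ∧ s (G.pair h, false) (G.pair h, true) := by
  refine glue_le_iff.trans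
    ⟨fun hs => ⟨hs (h, false) (Or.inl rfl), hs (G.pair h, false) (Or.inr rfl)⟩, ?_⟩
  rintro ⟨hs, hs'⟩ ⟨x, _ | _⟩ (rfl | rfl)
  exacts [hs, hs', s.symm' hs, s.symm' hs']

theorem sup_glue_strand {s : Setoid (H × Bool)} (hs : glue (G.edgeCrosses h) flip ≤ s) :
    s ⊔ glue (G.edgeCrosses h) G.strand = s ⊔ glue {(h, false)} fun _ => (G.pair h, false) := by
  set t := s ⊔ glue {(h, false)} fun _ => (G.pair h, false)
  obtain ⟨hs, hs'⟩ := glue_flip_le_iff.1 hs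
  have rel_false : t (h, false) (G.pair h, false) := sup_of_rel_right (glue_rel _ rfl)
  have rel_true : t (h, true) (G.pair h, true) := t.trans' (sup_of_rel_left (s.symm' hs))
    (t.trans' rel_false (sup_of_rel_left hs'))
  refine le_antisymm (sup_le le_sup_left (glue_strand_le_iff.2 (Bool.rec rel_false rel_true)))
    (sup_le le_sup_left (glue_le_iff.2 ?_))
  rintro _ rfl
  exact sup_of_rel_right (glue_rel G.strand (Or.inl rfl))

theorem sup_glue_flip {s : Setoid (H × Bool)} (hs : glue (G.edgeCrosses h) G.strand ≤ s) :
    s ⊔ glue (G.edgeCrosses h) flip = s ⊔ glue {(h, false)} fun _ => (h, true) := by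
  set t := s ⊔ glue {(h, false)} fun _ => (h, true)
  have hs := glue_strand_le_iff.1 hs
  have rel : t (h, false) (h, true) := sup_of_rel_right (glue_rel _ rfl)
  have rel_pair : t (G.pair h, false) (G.pair h, true) :=
    t.trans' (sup_of_rel_left (s.symm' (hs false))) (t.trans' rel (sup_of_rel_left (hs true)))
  refine le_antisymm (sup_le le_sup_left (glue_flip_le_iff.2 ⟨rel, rel_pair⟩))
    (sup_le le_sup_left (glue_le_iff.2 ?_))
  rintro _ rfl
  exact sup_of_rel_right (glue_rel flip (Or.inl rfl))

theorem IsLoop.glue_strand_le (hloop : G.IsLoop h) :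
    glue (G.edgeCrosses h) G.strand ≤ G.vertexSetoid := by
  refine glue_strand_le_iff.2 fun b => ?_
  have rel_flip (x : H) (b c : Bool) : G.vertexSetoid (x, b) (x, c) :=
    rel_of_glue_flip_le le_sup_right x b c
  exact Setoid.trans' _ (rel_flip h b false)
    (Setoid.trans' _ (isLoop_iff.1 hloop) (rel_flip _ false b))

theorem flip_flip (x : H × Bool) : flip (flip x) = x := by simp [flip]

theorem flip_ne (x : H × Bool) : flip x ≠ x := fun h => Bool.not_ne_self x.2 (congrArg Prod.snd h)

theorem jump_jump (x : H × Bool) : G.jump (G.jump x) = x := by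
  by_cases hx : G.IsFlag x.1
  · rw [jump_of_isFlag _ hx, jump_of_isFlag (x := flip x) _ hx, flip_flip]
  · have hx' : ¬ G.IsFlag (G.strand x).1 := fun h =>
      hx (by rwa [IsFlag, strand, G.pair_pair, eq_comm] at h)
    rw [jump_of_not_isFlag _ hx, jump_of_not_isFlag _ hx', strand, strand, G.pair_pair]

theorem jump_ne (x : H × Bool) : G.jump x ≠ x := by
  by_cases hx : G.IsFlag x.1
  · exact jump_of_isFlag _ hx ▸ flip_ne x
  · exact jump_of_not_isFlag _ hx ▸ fun h => hx (congrArg Prod.fst h)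

namespace IsTrivialLoop

theorem not_rel (htriv : G.IsTrivialLoop h) {s : Setoid (H × Bool)} (hs : s ≤ G.linkSetoid h)
    (b : Bool) : ¬ s (h, b) (h, !b) := by
  have not_rel_link := mt linkedOff_iff.2 htriv.2
  cases b
  exacts [fun hb => not_rel_link (hs hb), fun hb => not_rel_link (Setoid.symm' _ (hs hb))]

theorem exists_rel_pair (htriv : G.IsTrivialLoop h) {s : Setoid (H × Bool)}
    (hs : s ≤ G.linkSetoid h)
    (partner : ∀ x : H × Bool, G.OnEdge h x.1 → ∃ y, G.OnEdge h y.1 ∧ y ≠ x ∧ s x y) (b : Bool) :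
    ∃ d, s (h, b) (G.pair h, d) := by
  obtain ⟨⟨y, d⟩, rfl | rfl, hne, hy⟩ := partner (h, b) (Or.inl rfl)
  · obtain rfl : d = !b := by
      cases b <;> cases d <;> simp_all
    exact absurd hy (htriv.not_rel hs b)
  · exact ⟨d, hy⟩

theorem rel_pair_xor (htriv : G.IsTrivialLoop h) {s : Setoid (H × Bool)}
    (hs : s ≤ G.linkSetoid h)
    (partner : ∀ x : H × Bool, G.OnEdge h x.1 → ∃ y, G.OnEdge h y.1 ∧ y ≠ x ∧ s x y) {c : Bool}
    (hc : G.linkSetoid h (h, false) (G.pair h, c)) (b : Bool) :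
    s (h, b) (G.pair h, xor b c) := by
  choose d hd using htriv.exists_rel_pair hs partner
  have ne_of_link {b : Bool} (hb : G.linkSetoid h (h, false) (G.pair h, b)) : b ≠ d true := by
    rintro rfl
    exact htriv.not_rel le_rfl false (Setoid.trans' _ hb (Setoid.symm' _ (hs (hd true))))
  have d_false : d false = c := by
    rw [Bool.eq_not.2 (ne_of_link hc), Bool.eq_not.2 (ne_of_link (hs (hd false)))]
  have d_true : d true = !c := Bool.eq_not.2 (ne_of_link hc).symm
  cases b
  · simpa only [Bool.false_xor, d_false] using hd false
  · simpa only [Bool.true_xor, d_true] using hd true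

end IsTrivialLoop

variable [Finite H]

theorem exists_ne_sideSetoid {x : H × Bool} (hx : G.OnEdge h x.1) :
    ∃ y, G.OnEdge h y.1 ∧ y ≠ x ∧ G.sideSetoid h x y :=
  exists_ne_sup_glue G.arc_arc G.arc_ne (fun x _ => flip_flip x) (fun x _ => flip_ne x)
    mapsTo_flip_compl hx

theorem exists_ne_rimSetoid {x : H × Bool} (hx : G.OnEdge h x.1) :
    ∃ y, G.OnEdge h y.1 ∧ y ≠ x ∧ G.rimSetoid h x y :=
  exists_ne_sup_glue G.arc_arc G.arc_ne (fun x _ => jump_jump x) (fun x _ => jump_ne x)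
    mapsTo_jump_compl hx

theorem glue_flip_le_sideSetoid (hloop : ¬ G.IsLoop h) :
    glue (G.edgeCrosses h) flip ≤ G.sideSetoid h := by
  have side_le : G.sideSetoid h ≤ G.vertexSetoid := sideSetoid_sup_glue_flip G h ▸ le_sup_left
  have not_rel (b c : Bool) : ¬ G.sideSetoid h (h, b) (G.pair h, c) := fun hbc =>
    hloop (isLoop_iff.2 (Setoid.trans' _ (rel_of_glue_flip_le le_sup_right h false b)
      (Setoid.trans' _ (side_le hbc) (rel_of_glue_flip_le le_sup_right _ c false))))
  refine glue_flip_le_iff.2 ⟨?_, ?_⟩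
  · obtain ⟨⟨y, _ | _⟩, rfl | rfl, hne, hy⟩ :=
      exists_ne_sideSetoid (G := G) (h := h) (x := (h, false)) (Or.inl rfl)
    exacts [absurd rfl hne, absurd hy (not_rel _ _), hy, absurd hy (not_rel _ _)]
  · obtain ⟨⟨y, _ | _⟩, rfl | rfl, hne, hy⟩ :=
      exists_ne_sideSetoid (G := G) (h := h) (x := (G.pair h, false)) (Or.inr rfl)
    exacts [absurd (Setoid.symm' _ hy) (not_rel _ _), absurd rfl hne,
      absurd (Setoid.symm' _ hy) (not_rel _ _), hy]

namespace IsTrivialLoop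

theorem glue_strand_le (htriv : G.IsTrivialLoop h) (hunt : G.IsUntwistedLoop h) :
    glue (G.edgeCrosses h) G.strand ≤ G.sideSetoid h := by
  refine glue_strand_le_iff.2 fun b => ?_
  have := htriv.rel_pair_xor le_sup_left (fun _ => exists_ne_sideSetoid)
    (sup_of_rel_left (sameSide_iff.1 hunt.2)) b
  rwa [Bool.xor_false] at this

theorem rimSetoid_sup_glue_flip (htriv : G.IsTrivialLoop h) (htw : G.IsTwistedLoop h)
    (hh : G.pair h ≠ h) :
    G.rimSetoid h ⊔ glue (G.edgeCrosses h) flip = G.boundarySetoid := by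
  obtain ⟨_ | _, hc⟩ := htriv.exists_rel_pair le_sup_left (fun _ => exists_ne_sideSetoid) false
  · exact absurd (sameSide_iff.2 hc) htw.2
  have rim (b : Bool) : G.rimSetoid h (h, b) (G.pair h, !b) := by
    rw [← Bool.xor_true]
    exact htriv.rel_pair_xor (rimSetoid_le_linkSetoid G h) (fun _ => exists_ne_rimSetoid)
      (sup_of_rel_left hc) b
  rw [← rimSetoid_sup_glue_strand G h hh]
  refine le_antisymm (sup_le le_sup_left ?_) (sup_le le_sup_left ?_)
  · have strand (b : Bool) : (G.rimSetoid h ⊔ glue (G.edgeCrosses h) G.strand) (h, b)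
        (G.pair h, b) := glue_strand_le_iff.1 le_sup_right b
    exact glue_flip_le_iff.2
      ⟨Setoid.trans' _ (sup_of_rel_left (rim false)) (Setoid.symm' _ (strand true)),
      Setoid.trans' _ (Setoid.symm' _ (sup_of_rel_left (rim true))) (strand true)⟩
  · exact glue_strand_le_iff.2 fun b => Setoid.trans' _
      (sup_of_rel_right (glue_rel flip (Or.inl rfl)))
      (sup_of_rel_left (by simpa only [flip, Bool.not_not] using rim (!b)))

end IsTrivialLoop

end EdgeTypes

section Edges

variable {H : Type*} {G : RibbonGraph H} {h : H}

theorem mk_pair_eq_iff {x : H} : s(x, G.pair x) = s(h, G.pair h) ↔ G.OnEdge h x := by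
  refine Sym2.eq_iff.trans ⟨Or.imp And.left And.left, ?_⟩
  rintro (rfl | rfl)
  exacts [Or.inl ⟨rfl, rfl⟩, Or.inr ⟨rfl, G.pair_pair h⟩]

theorem eq_of_pair_eq {K : RibbonGraph H} (hpair : ∀ x, G.pair x = K.pair x) (harc : G.arc = K.arc)
    (hiso : G.isolated = K.isolated) : G = K := by
  have : G.pair = K.pair := funext hpair
  cases G
  cases K
  simp_all only

variable [DecidableEq H]

theorem sub_pair (A : Finset (Sym2 H)) (x : H) :
    (G.sub A).pair x = if s(x, G.pair x) ∈ A then G.pair x else x := rfl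

theorem cut_pair_of_onEdge {x : H} (hx : G.OnEdge h x) : (G.cut h).pair x = x := if_pos hx

theorem cut_pair_of_not_onEdge {x : H} (hx : ¬ G.OnEdge h x) : (G.cut h).pair x = G.pair x :=
  if_neg hx

variable [Fintype H]

theorem mem_edges {e : Sym2 H} : e ∈ G.edges ↔ ∃ x, G.pair x ≠ x ∧ s(x, G.pair x) = e := by
  simp only [edges, Finset.mem_image, Finset.mem_filter, Finset.mem_univ, true_and]

theorem mem_edges_cut {e : Sym2 H} : e ∈ (G.cut h).edges ↔ e ∈ G.edges ∧ e ≠ s(h, G.pair h) := by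
  rw [mem_edges, mem_edges]
  constructor
  · rintro ⟨x, hx, rfl⟩
    have hxh : ¬ G.OnEdge h x := fun hxh => hx (cut_pair_of_onEdge hxh)
    rw [cut_pair_of_not_onEdge hxh] at hx ⊢
    exact ⟨⟨x, hx, rfl⟩, mt mk_pair_eq_iff.1 hxh⟩
  · rintro ⟨⟨x, hx, rfl⟩, hxh⟩
    have hcut := cut_pair_of_not_onEdge (mt mk_pair_eq_iff.2 hxh)
    exact ⟨x, by rwa [hcut], by rw [hcut]⟩

theorem notMem_edges_cut : s(h, G.pair h) ∉ (G.cut h).edges := fun he => (mem_edges_cut.1 he).2 rfl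

theorem insert_edges_cut (hh : G.pair h ≠ h) :
    insert s(h, G.pair h) (G.cut h).edges = G.edges := by
  ext e
  rw [Finset.mem_insert, mem_edges_cut]
  by_cases he : e = s(h, G.pair h)
  · simp only [he, true_or, true_iff]
    exact mem_edges.2 ⟨h, hh, rfl⟩
  · simp only [he, false_or, ne_eq, not_false_eq_true, and_true]

theorem sub_cut {A : Finset (Sym2 H)} (hA : A ⊆ (G.cut h).edges) : (G.cut h).sub A = G.sub A := by
  refine eq_of_pair_eq (fun x => ?_) rfl rfl
  rw [sub_pair, sub_pair]
  by_cases hx : G.OnEdge h x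
  · rw [cut_pair_of_onEdge hx, mk_pair_eq_iff.2 hx, ite_self,
      if_neg fun he => notMem_edges_cut (hA he)]
  · rw [cut_pair_of_not_onEdge hx]

namespace IsSplice

variable {R : Type*} [Fintype R] [DecidableEq R] {L : RibbonGraph R} {ι : R → H}
  {σ : H × Bool → H × Bool}

theorem image_edges (hL : G.IsSplice h σ L ι) : L.edges.image (Sym2.map ι) = (G.cut h).edges := by
  ext e
  rw [Finset.mem_image, mem_edges_cut]
  constructor
  · rintro ⟨_, he, rfl⟩
    obtain ⟨x, hx, rfl⟩ := mem_edges.1 he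
    rw [Sym2.map_mk, hL.pair_eq, ne_eq, mk_pair_eq_iff, ← hL.mem_range_iff]
    exact ⟨mem_edges.2 ⟨ι x, by rwa [← hL.pair_eq, hL.injective.ne_iff], rfl⟩, x, rfl⟩
  · rintro ⟨he, hxh⟩
    obtain ⟨x, hne, rfl⟩ := mem_edges.1 he
    obtain ⟨x, rfl⟩ := (hL.mem_range_iff x).2 (mt mk_pair_eq_iff.2 hxh)
    rw [← hL.pair_eq] at hne ⊢
    exact ⟨_, mem_edges.2 ⟨x, hL.injective.ne_iff.1 hne, rfl⟩, rfl⟩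

theorem card_edges (hL : G.IsSplice h σ L ι) (hh : G.pair h ≠ h) :
    G.edges.card = L.edges.card + 1 := by
  rw [← insert_edges_cut hh, Finset.card_insert_of_notMem notMem_edges_cut, ← hL.image_edges,
    Finset.card_image_of_injective _ (Sym2.map.injective hL.injective)]

end IsSplice

end Edges

section Subgraphs

variable {H : Type*} [DecidableEq H] {G : RibbonGraph H} {h : H} {A : Finset (Sym2 H)}

theorem pair_sub (hA : s(h, G.pair h) ∈ A) : (G.sub A).pair h = G.pair h := if_pos hA

theorem onEdge_sub (hA : s(h, G.pair h) ∈ A) {x : H} : (G.sub A).OnEdge h x ↔ G.OnEdge h x := by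
  rw [OnEdge, OnEdge, pair_sub hA]

theorem edgeCrosses_sub (hA : s(h, G.pair h) ∈ A) : (G.sub A).edgeCrosses h = G.edgeCrosses h :=
  Set.ext fun _ => onEdge_sub hA

theorem strand_sub_eq_or (x : H × Bool) : (G.sub A).strand x = G.strand x ∨
    (G.sub A).strand x = x := by
  rw [strand, sub_pair]
  split_ifs
  exacts [Or.inl rfl, Or.inr rfl]

theorem glue_strand_sub_le (S : Set (H × Bool)) : glue S (G.sub A).strand ≤ glue S G.strand := by
  refine glue_le_iff.2 fun x hx => ?_
  obtain hstrand | hstrand := strand_sub_eq_or (G := G) (A := A) x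
  · exact hstrand ▸ glue_rel G.strand hx
  · exact hstrand.symm ▸ Setoid.refl' _ x

theorem eqOn_strand_sub (hA : s(h, G.pair h) ∈ A) :
    Set.EqOn G.strand (G.sub A).strand ((G.sub A).edgeCrosses h) := by
  intro x hx
  rw [edgeCrosses_sub hA] at hx
  rw [strand, strand, sub_pair, mk_pair_eq_iff.2 hx, if_pos hA]

theorem sideSetoid_sub (hA : s(h, G.pair h) ∈ A) : (G.sub A).sideSetoid h = G.sideSetoid h := by
  rw [sideSetoid, edgeCrosses_sub hA]
  rfl

theorem linkSetoid_sub_le (hA : s(h, G.pair h) ∈ A) : (G.sub A).linkSetoid h ≤ G.linkSetoid h := by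
  rw [linkSetoid, sideSetoid_sub hA, edgeCrosses_sub hA]
  exact sup_le_sup_left (glue_strand_sub_le _) _

theorem isLoop_sub (hA : s(h, G.pair h) ∈ A) : (G.sub A).IsLoop h ↔ G.IsLoop h := by
  rw [isLoop_iff, isLoop_iff, pair_sub hA]
  rfl

theorem IsTrivialLoop.sub (hA : s(h, G.pair h) ∈ A) (htriv : G.IsTrivialLoop h) :
    (G.sub A).IsTrivialLoop h :=
  ⟨(isLoop_sub hA).2 htriv.1, fun hlink =>
    htriv.2 (linkedOff_iff.2 (linkSetoid_sub_le hA (linkedOff_iff.1 hlink)))⟩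

theorem sameSide_sub (hA : s(h, G.pair h) ∈ A) {x y : H × Bool} :
    (G.sub A).SameSide h x y ↔ G.SameSide h x y := by
  rw [sameSide_iff, sameSide_iff, sideSetoid_sub hA]

theorem isUntwistedLoop_sub (hA : s(h, G.pair h) ∈ A) :
    (G.sub A).IsUntwistedLoop h ↔ G.IsUntwistedLoop h := by
  rw [IsUntwistedLoop, IsUntwistedLoop, isLoop_sub hA, pair_sub hA, sameSide_sub hA]

theorem isTwistedLoop_sub (hA : s(h, G.pair h) ∈ A) :
    (G.sub A).IsTwistedLoop h ↔ G.IsTwistedLoop h := by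
  rw [IsTwistedLoop, IsTwistedLoop, isLoop_sub hA, pair_sub hA, sameSide_sub hA]

namespace IsSplice

variable {R : Type*} {L : RibbonGraph R} {ι : R → H} {σ : H × Bool → H × Bool}

theorem sub [DecidableEq R] (hL : G.IsSplice h σ L ι) (B : Finset (Sym2 R)) :
    (G.sub (insert s(h, G.pair h) (B.image (Sym2.map ι)))).IsSplice h σ (L.sub B) ι := by
  have hA := Finset.mem_insert_self s(h, G.pair h) (B.image (Sym2.map ι))
  refine ⟨hL.injective, fun x => (hL.mem_range_iff x).trans (onEdge_sub hA).symm.not, fun x => ?_,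
    ?_, ?_⟩
  · have hx : s(ι x, G.pair (ι x)) ∈ insert s(h, G.pair h) (B.image (Sym2.map ι)) ↔
        s(x, L.pair x) ∈ B := by
      rw [Finset.mem_insert, mk_pair_eq_iff, ← hL.pair_eq, ← Sym2.map_mk,
        (Sym2.map.injective hL.injective).mem_finset_image,
        or_iff_right ((hL.mem_range_iff _).1 ⟨x, rfl⟩)]
    simp only [sub_pair, hx, apply_ite ι, hL.pair_eq]
  · rw [edgeCrosses_sub hA]
    exact hL.comap_eq
  · rw [edgeCrosses_sub hA]
    exact hL.isolated_eq

end IsSplice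

end Subgraphs

section Ranks

variable {H : Type*} {G : RibbonGraph H} {h : H}

theorem numVertices_cut [DecidableEq H] : (G.cut h).numVertices = G.numVertices := rfl

theorem componentSetoid_cut [DecidableEq H] :
    (G.cut h).componentSetoid = G.linkSetoid h ⊔ glue (G.edgeCrosses h) flip := by
  have strand_on {x : H × Bool} (hx : x ∈ G.edgeCrosses h) : (G.cut h).strand x = x :=
    Prod.ext (cut_pair_of_onEdge hx) rfl
  have strand_off : Set.EqOn (G.cut h).strand G.strand (G.edgeCrosses h)ᶜ :=
    fun x hx => Prod.ext (cut_pair_of_not_onEdge hx) rfl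
  have glue_le : glue (G.edgeCrosses h) (G.cut h).strand ≤ (G.cut h).vertexSetoid :=
    glue_le_iff.2 fun x hx => (strand_on hx).symm ▸ Setoid.refl' _ x
  rw [componentSetoid, ← glue_sup_glue_compl (G.edgeCrosses h), ← sup_assoc, sup_eq_left.2 glue_le,
    glue_congr strand_off, linkSetoid, sup_right_comm, sideSetoid_sup_glue_flip]
  rfl

theorem componentSetoid_cut_sup_glue [DecidableEq H] : (G.cut h).componentSetoid ⊔
    glue {(h, false)} (fun _ => (G.pair h, false)) = G.componentSetoid := by
  rw [componentSetoid_cut, ← sup_glue_strand le_sup_right, linkSetoid_sup_glue]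

variable [Finite H]

theorem numComponents_le_numVertices (G : RibbonGraph H) : G.numComponents ≤ G.numVertices := by
  rw [numComponents_eq, numVertices_eq]
  exact Nat.add_le_add_right (numClasses_le_of_le le_sup_left) _

variable [DecidableEq H]

theorem rank_sub_le (A : Finset (Sym2 H)) : (G.sub A).rank ≤ G.rank := by
  have : G.numComponents ≤ (G.sub A).numComponents := by
    rw [numComponents_eq, numComponents_eq]
    exact Nat.add_le_add_right
      (numClasses_le_of_le (sup_le_sup_left (glue_strand_sub_le _) G.vertexSetoid)) _
  exact Nat.sub_le_sub_left this _

theorem numComponents_le_numComponents_cut : G.numComponents ≤ (G.cut h).numComponents := by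
  rw [numComponents_eq, numComponents_eq, ← componentSetoid_cut_sup_glue (h := h)]
  exact Nat.add_le_add_right (numClasses_le_of_le le_sup_left) _

theorem numComponents_cut_le : (G.cut h).numComponents ≤ G.numComponents + 1 := by
  rw [numComponents_eq, numComponents_eq, ← componentSetoid_cut_sup_glue (G := G) (h := h),
    Nat.add_right_comm]
  exact Nat.add_le_add_right (numClasses_le_add_one _ _ _) _

theorem numComponents_cut_of_isLoop (hloop : G.IsLoop h) :
    (G.cut h).numComponents = G.numComponents := by
  have glue_le : glue (G.edgeCrosses h) G.strand ≤ (G.cut h).componentSetoid :=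
    hloop.glue_strand_le.trans le_sup_left
  rw [numComponents_eq, numComponents_eq, ← linkSetoid_sup_glue G h, ← componentSetoid_cut,
    sup_eq_left.2 glue_le]
  rfl

theorem rank_eq_rank_cut_add {i : ℕ} (hk : (G.cut h).numComponents = G.numComponents + i) :
    G.rank = (G.cut h).rank + i := by
  have := numComponents_le_numVertices (G.cut h)
  rw [numVertices_cut] at this
  rw [rank, rank, numVertices_cut]
  omega

end Ranks

section EdgeCount

variable {H : Type*} [Fintype H] [DecidableEq H]

theorem numVertices_le_card_edges_add_numComponents (G : RibbonGraph H) :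
    G.numVertices ≤ G.edges.card + G.numComponents := by
  induction hn : G.edges.card generalizing G with
  | zero =>
    have isFlag (x : H) : G.IsFlag x := not_not.1 fun hx =>
      Finset.notMem_empty s(x, G.pair x) (Finset.card_eq_zero.1 hn ▸ mem_edges.2 ⟨x, hx, rfl⟩)
    have glue_le : glue Set.univ G.strand ≤ G.vertexSetoid :=
      glue_le_iff.2 fun x _ => (G.strand_of_isFlag (isFlag x.1)).symm ▸ Setoid.refl' _ x
    rw [numVertices_eq, numComponents_eq, componentSetoid, sup_eq_left.2 glue_le, zero_add]
  | succ n ih =>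
    obtain ⟨e, he⟩ := Finset.card_pos.1 (n.succ_pos.trans_eq hn.symm)
    obtain ⟨h, hh, rfl⟩ := mem_edges.1 he
    rw [← insert_edges_cut hh, Finset.card_insert_of_notMem notMem_edges_cut] at hn
    have vertices_le := ih (G.cut h) (Nat.succ_injective hn)
    have components_le := numComponents_cut_le (G := G) (h := h)
    rw [numVertices_cut] at vertices_le
    omega

end EdgeCount

section Weights

open LaurentPolynomial

/-- The part of the term of `ℛ` belonging to a spanning c-subgraph `G` which depends on `G`
alone. -/
noncomputable def brWeight {H : Type*} [Fintype H] [DecidableEq H] (G : RibbonGraph H) :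
    LaurentPolynomial (MvPolynomial (Fin 4) ℤ) :=
  C ((MvPolynomial.X 1 - 1) ^ G.nullity)
    * T ((G.numComponents : ℤ) - G.numClosedFaces + G.nullity)
    * C (MvPolynomial.X 2 ^ G.numBoundaryComponents * MvPolynomial.X 3 ^ G.numFlags)

variable {H R : Type*} [Fintype H] [DecidableEq H] [Fintype R] [DecidableEq R]
  {G : RibbonGraph H} {h : H} {L : RibbonGraph R} {ι : R → H} {σ : H × Bool → H × Bool}

theorem brPoly_eq_sum (G : RibbonGraph H) : G.brPoly = ∑ A ∈ G.edges.powerset,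
    C ((MvPolynomial.X 0 - 1) ^ (G.rank - (G.sub A).rank)) * (G.sub A).brWeight := by
  simp only [brPoly, brWeight, map_mul, mul_assoc]

theorem brWeight_eq_mul {K : RibbonGraph R} {j : ℕ} {m : ℤ} (hn : G.nullity = K.nullity + j)
    (hz : (G.numComponents : ℤ) + j = K.numComponents + m)
    (hF : K.numClosedFaces = G.numClosedFaces)
    (hb : K.numBoundaryComponents = G.numBoundaryComponents) (hf : K.numFlags = G.numFlags) :
    G.brWeight = C ((MvPolynomial.X 1 - 1) ^ j) * T m * K.brWeight := by
  have exponent : (G.numComponents : ℤ) - G.numClosedFaces + G.nullity =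
      m + (K.numComponents - K.numClosedFaces + K.nullity) := by
    rw [hn, hF]
    push_cast
    linarith
  rw [brWeight, brWeight, exponent, hn, hb, hf, T_add, pow_add, map_mul]
  ring

theorem brPoly_eq_add (hL : G.IsSplice h σ L ι) (hh : G.pair h ≠ h) {i : ℕ}
    (hk : (G.cut h).numComponents = G.numComponents + i)
    {w : LaurentPolynomial (MvPolynomial (Fin 4) ℤ)}
    (hsub : ∀ (A : Finset (Sym2 H)) (B : Finset (Sym2 R)), s(h, G.pair h) ∈ A →
      (G.sub A).IsSplice h σ (L.sub B) ι →
        G.rank - (G.sub A).rank = L.rank - (L.sub B).rank ∧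
          (G.sub A).brWeight = w * (L.sub B).brWeight) :
    G.brPoly = C ((MvPolynomial.X 0 - 1) ^ i) * (G.cut h).brPoly + w * L.brPoly := by
  have map_injective : Function.Injective (Finset.image (Sym2.map ι)) :=
    Finset.image_injective (Sym2.map.injective hL.injective)
  have without_edge (A : Finset (Sym2 H)) (hA : A ∈ (G.cut h).edges.powerset) :
      C ((MvPolynomial.X 0 - 1) ^ (G.rank - (G.sub A).rank)) * (G.sub A).brWeight =
        C ((MvPolynomial.X 0 - 1) ^ i) *
          (C ((MvPolynomial.X 0 - 1) ^ ((G.cut h).rank - ((G.cut h).sub A).rank)) *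
            ((G.cut h).sub A).brWeight) := by
    have rank_le := rank_sub_le (G := G.cut h) A
    have rank_eq : G.rank - ((G.cut h).sub A).rank =
        i + ((G.cut h).rank - ((G.cut h).sub A).rank) := by
      rw [rank_eq_rank_cut_add hk]
      omega
    rw [← sub_cut (Finset.mem_powerset.1 hA), rank_eq, pow_add, map_mul, mul_assoc]
  have with_edge (B : Finset (Sym2 R)) :
      C ((MvPolynomial.X 0 - 1) ^
          (G.rank - (G.sub (insert s(h, G.pair h) (B.image (Sym2.map ι)))).rank)) *
            (G.sub (insert s(h, G.pair h) (B.image (Sym2.map ι)))).brWeight =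
        w * (C ((MvPolynomial.X 0 - 1) ^ (L.rank - (L.sub B).rank)) * (L.sub B).brWeight) := by
    obtain ⟨rank_eq, brWeight_eq⟩ := hsub _ B (Finset.mem_insert_self _ _) (hL.sub B)
    rw [rank_eq, brWeight_eq, mul_left_comm]
  rw [brPoly_eq_sum, ← insert_edges_cut hh, Finset.sum_powerset_insert notMem_edges_cut,
    Finset.sum_congr rfl without_edge, ← Finset.mul_sum, ← brPoly_eq_sum, ← hL.image_edges,
    Finset.powerset_image, Finset.sum_image map_injective.injOn,
    Finset.sum_congr rfl fun B _ => with_edge B, ← Finset.mul_sum, ← brPoly_eq_sum]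

end Weights

section Splicing

variable {H R : Type*} [Finite H] {G : RibbonGraph H} {h : H} {L : RibbonGraph R} {ι : R → H}

namespace IsSplice

theorem numVertices_of_not_isLoop (hL : G.IsSplice h G.strand L ι) (hloop : ¬ G.IsLoop h) :
    G.numVertices = L.numVertices + 1 := by
  have flip_le := glue_flip_le_sideSetoid hloop
  have side_eq : G.sideSetoid h = G.vertexSetoid := by
    rw [← sideSetoid_sup_glue_flip G h, sup_eq_left.2 flip_le]
  have not_rel : ¬ G.sideSetoid h (h, false) (G.pair h, false) := by
    rwa [side_eq, ← isLoop_iff]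
  rw [RibbonGraph.numVertices_eq, hL.numVertices_eq, ← side_eq, sup_glue_strand flip_le,
    numClasses_eq_add_one not_rel, Nat.add_right_comm]

theorem numComponents_of_not_isLoop (hL : G.IsSplice h G.strand L ι) (hloop : ¬ G.IsLoop h) :
    G.numComponents = L.numComponents := by
  have flip_le := (glue_flip_le_sideSetoid hloop).trans (sideSetoid_le_linkSetoid G h)
  rw [RibbonGraph.numComponents_eq, hL.numComponents_eq, ← linkSetoid_sup_glue G h,
    sup_eq_left.2 flip_le]

theorem numVertices_of_untwisted (hL : G.IsSplice h G.strand L ι) (htriv : G.IsTrivialLoop h)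
    (hunt : G.IsUntwistedLoop h) : L.numVertices = G.numVertices + 1 := by
  have strand_le := htriv.glue_strand_le hunt
  rw [hL.numVertices_eq, RibbonGraph.numVertices_eq, ← sideSetoid_sup_glue_flip G h,
    sup_eq_left.2 strand_le, sup_glue_flip strand_le,
    numClasses_eq_add_one (htriv.not_rel le_sup_left false), Nat.add_right_comm, Bool.not_false]

theorem numComponents_of_untwisted (hL : G.IsSplice h G.strand L ι) (htriv : G.IsTrivialLoop h)
    (hunt : G.IsUntwistedLoop h) : L.numComponents = G.numComponents + 1 := by
  have strand_le := (htriv.glue_strand_le hunt).trans (sideSetoid_le_linkSetoid G h)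
  rw [hL.numComponents_eq, RibbonGraph.numComponents_eq, ← linkSetoid_sup_glue G h, sup_right_comm,
    sup_eq_left.2 strand_le, sup_glue_flip strand_le,
    numClasses_eq_add_one (htriv.not_rel le_rfl false), Nat.add_right_comm, Bool.not_false]

theorem numVertices_of_flip (hL : G.IsSplice h flip L ι) : L.numVertices = G.numVertices := by
  rw [hL.numVertices_eq, sideSetoid_sup_glue_flip, RibbonGraph.numVertices_eq]

theorem numComponents_of_flip [DecidableEq H] (hL : G.IsSplice h flip L ι) :
    L.numComponents = (G.cut h).numComponents := by
  rw [hL.numComponents_eq, RibbonGraph.numComponents_eq, componentSetoid_cut]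
  rfl

theorem rank_of_not_isLoop (hL : G.IsSplice h G.strand L ι) (hloop : ¬ G.IsLoop h) :
    G.rank = L.rank + 1 := by
  have := Finite.of_injective ι hL.injective
  have := numComponents_le_numVertices L
  rw [rank, rank, hL.numVertices_of_not_isLoop hloop, hL.numComponents_of_not_isLoop hloop]
  omega

theorem rank_of_untwisted (hL : G.IsSplice h G.strand L ι) (htriv : G.IsTrivialLoop h)
    (hunt : G.IsUntwistedLoop h) : G.rank = L.rank := by
  rw [rank, rank, hL.numVertices_of_untwisted htriv hunt,
    hL.numComponents_of_untwisted htriv hunt, Nat.add_sub_add_right]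

theorem rank_of_flip (hL : G.IsSplice h flip L ι) (hloop : G.IsLoop h) : G.rank = L.rank := by
  classical
  rw [rank, rank, hL.numVertices_of_flip, hL.numComponents_of_flip,
    numComponents_cut_of_isLoop hloop]

end IsSplice

end Splicing

section Reductions

open LaurentPolynomial

variable {H R : Type*} [Fintype H] [DecidableEq H] [Fintype R] [DecidableEq R]
  {G : RibbonGraph H} {h : H} {L : RibbonGraph R} {ι : R → H}

namespace IsSplice

theorem brWeight_of_not_isLoop (hL : G.IsSplice h G.strand L ι) (hh : G.pair h ≠ h)
    (hloop : ¬ G.IsLoop h) : G.brWeight = L.brWeight := by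
  have rim_eq := rimSetoid_sup_glue_strand G h hh
  have components_eq := hL.numComponents_of_not_isLoop hloop
  have nullity_eq : G.nullity = L.nullity + 0 := by
    rw [nullity, nullity, hL.card_edges hh, components_eq, hL.numVertices_of_not_isLoop hloop]
    omega
  have exponent_eq : (G.numComponents : ℤ) + (0 : ℕ) = L.numComponents + 0 := by
    rw [components_eq, Nat.cast_zero]
  rw [brWeight_eq_mul nullity_eq exponent_eq (hL.numClosedFaces_eq hh rim_eq)
    (hL.numBoundaryComponents_eq hh rim_eq) (hL.numFlags_eq hh), pow_zero, map_one, T_zero,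
    one_mul, one_mul]

theorem brWeight_of_untwisted (hL : G.IsSplice h G.strand L ι) (hh : G.pair h ≠ h)
    (htriv : G.IsTrivialLoop h) (hunt : G.IsUntwistedLoop h) :
    G.brWeight = C (MvPolynomial.X 1 - 1) * L.brWeight := by
  have rim_eq := rimSetoid_sup_glue_strand G h hh
  have components_eq := hL.numComponents_of_untwisted htriv hunt
  have nullity_eq : G.nullity = L.nullity + 1 := by
    have := numVertices_le_card_edges_add_numComponents L
    rw [components_eq, hL.numVertices_of_untwisted htriv hunt] at this
    rw [nullity, nullity, hL.card_edges hh, components_eq, hL.numVertices_of_untwisted htriv hunt]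
    omega
  have exponent_eq : (G.numComponents : ℤ) + (1 : ℕ) = L.numComponents + 0 := by
    rw [components_eq, Nat.cast_add, add_zero]
  rw [brWeight_eq_mul nullity_eq exponent_eq (hL.numClosedFaces_eq hh rim_eq)
    (hL.numBoundaryComponents_eq hh rim_eq) (hL.numFlags_eq hh), pow_one, T_zero, mul_one]

theorem brWeight_of_twisted (hL : G.IsSplice h flip L ι) (hh : G.pair h ≠ h)
    (htriv : G.IsTrivialLoop h) (htw : G.IsTwistedLoop h) :
    G.brWeight = C (MvPolynomial.X 1 - 1) * T 1 * L.brWeight := by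
  have rim_eq := htriv.rimSetoid_sup_glue_flip htw hh
  have components_eq : L.numComponents = G.numComponents := by
    rw [hL.numComponents_of_flip, numComponents_cut_of_isLoop htriv.1]
  have nullity_eq : G.nullity = L.nullity + 1 := by
    have := numVertices_le_card_edges_add_numComponents L
    rw [components_eq, hL.numVertices_of_flip] at this
    rw [nullity, nullity, hL.card_edges hh, components_eq, hL.numVertices_of_flip]
    omega
  have exponent_eq : (G.numComponents : ℤ) + (1 : ℕ) = L.numComponents + 1 := by
    rw [components_eq, Nat.cast_one]
  rw [brWeight_eq_mul nullity_eq exponent_eq (hL.numClosedFaces_eq hh rim_eq)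
    (hL.numBoundaryComponents_eq hh rim_eq) (hL.numFlags_eq hh), pow_one]

theorem brPoly_of_not_isLoop (hL : G.IsSplice h G.strand L ι) (hh : G.pair h ≠ h)
    (hloop : ¬ G.IsLoop h) {i : ℕ} (hk : (G.cut h).numComponents = G.numComponents + i) :
    G.brPoly = C ((MvPolynomial.X 0 - 1) ^ i) * (G.cut h).brPoly + L.brPoly := by
  rw [← one_mul L.brPoly]
  refine brPoly_eq_add hL hh hk fun A B hA hAB => ?_
  replace hAB := hAB.congr (eqOn_strand_sub hA)
  have hloopA := mt (isLoop_sub hA).1 hloop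
  rw [hL.rank_of_not_isLoop hloop, hAB.rank_of_not_isLoop hloopA, Nat.add_sub_add_right,
    hAB.brWeight_of_not_isLoop ((pair_sub hA).trans_ne hh) hloopA, one_mul]
  exact ⟨rfl, rfl⟩

theorem brPoly_of_untwisted (hL : G.IsSplice h G.strand L ι) (hh : G.pair h ≠ h)
    (htriv : G.IsTrivialLoop h) (hunt : G.IsUntwistedLoop h) :
    G.brPoly = (G.cut h).brPoly + C (MvPolynomial.X 1 - 1) * L.brPoly := by
  have hk : (G.cut h).numComponents = G.numComponents + 0 := numComponents_cut_of_isLoop htriv.1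
  rw [brPoly_eq_add hL hh hk fun A B hA hAB => ?_, pow_zero, map_one, one_mul]
  replace hAB := hAB.congr (eqOn_strand_sub hA)
  have huntA := (isUntwistedLoop_sub hA).2 hunt
  rw [hL.rank_of_untwisted htriv hunt, hAB.rank_of_untwisted (htriv.sub hA) huntA]
  exact ⟨rfl, hAB.brWeight_of_untwisted ((pair_sub hA).trans_ne hh) (htriv.sub hA) huntA⟩

theorem brPoly_of_twisted (hL : G.IsSplice h flip L ι) (hh : G.pair h ≠ h)
    (htriv : G.IsTrivialLoop h) (htw : G.IsTwistedLoop h) :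
    G.brPoly = (G.cut h).brPoly + C (MvPolynomial.X 1 - 1) * T 1 * L.brPoly := by
  have hk : (G.cut h).numComponents = G.numComponents + 0 := numComponents_cut_of_isLoop htriv.1
  rw [brPoly_eq_add hL hh hk fun A B hA hAB => ?_, pow_zero, map_one, one_mul]
  have htwA := (isTwistedLoop_sub hA).2 htw
  rw [hL.rank_of_flip htriv.1, hAB.rank_of_flip htwA.1]
  exact ⟨rfl, hAB.brWeight_of_twisted ((pair_sub hA).trans_ne hh) (htriv.sub hA) htwA⟩

end IsSplice

end Reductions

section Bridges

variable {H : Type*} [Finite H] [DecidableEq H] {G : RibbonGraph H} {h : H}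

theorem isBridge_iff (hh : G.pair h ≠ h) :
    G.IsBridge h hh ↔ G.numComponents < (G.cut h).numComponents := by
  rw [IsBridge, delete, (isSplice_splice (pairsCrosses_flip hh)).numComponents_of_flip]

theorem IsBridge.not_isLoop {hh : G.pair h ≠ h} (hbridge : G.IsBridge h hh) : ¬ G.IsLoop h :=
  fun hloop => ((isBridge_iff hh).1 hbridge).ne' (numComponents_cut_of_isLoop hloop)

theorem IsBridge.numComponents_cut {hh : G.pair h ≠ h} (hbridge : G.IsBridge h hh) :
    (G.cut h).numComponents = G.numComponents + 1 :=
  numComponents_cut_le.antisymm ((isBridge_iff hh).1 hbridge)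

theorem IsRegular.numComponents_cut {hh : G.pair h ≠ h} (hreg : G.IsRegular h hh) :
    (G.cut h).numComponents = G.numComponents :=
  (not_lt.1 (mt (isBridge_iff hh).2 hreg.2)).antisymm numComponents_le_numComponents_cut

end Bridges

section InnerFace

variable {H : Type*} [DecidableEq H] {G : RibbonGraph H} {h : H}

theorem HasInnerFace.spliceArc_strand_eq (hin : G.HasInnerFace h) (hh : G.pair h ≠ h)
    {x : H × Bool} (hx : ¬ G.OnEdge h x.1) :
    G.spliceArc h G.strand x = G.spliceArc h flip x := by
  obtain ⟨b, hb⟩ := hin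
  have arc_eq {p : H × Bool} (hp : G.OnEdge h p.1) (hpb : p.2 = b) : G.arc p = G.strand p := by
    obtain ⟨p, c⟩ := p
    obtain rfl : c = b := hpb
    obtain hp | hp : p = h ∨ p = G.pair h := hp
    · rw [hp, hb, strand]
    · rw [hp, ← hb, G.arc_arc, hb, strand, G.pair_pair]
  have off := (spliceArc_spec (pairsCrosses_flip hh) hx).1
  rw [spliceArc] at off
  rw [spliceArc, spliceArc]
  by_cases hy : G.OnEdge h (G.arc x).1
  · have hyb : (flip (G.arc x)).2 = b := by
      refine Bool.not_eq.2 fun hyb => hx ?_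
      rw [← G.arc_arc x, arc_eq hy hyb]
      exact onEdge_pair_iff.2 hy
    have on : G.OnEdge h (G.strand (flip (G.arc x))).1 := onEdge_pair_iff.2 hy
    have flip_eq : G.spliceStep h flip (G.spliceStep h flip (G.arc x)) =
        G.arc (G.strand (G.arc x)) := by
      rw [spliceStep_on hy, arc_eq (p := flip (G.arc x)) hy hyb, spliceStep_on on]
      simp only [strand, flip, Bool.not_not]
    rw [flip_eq] at off ⊢
    rw [spliceStep_on hy, spliceStep_off off]
  · rw [spliceStep_off hy, spliceStep_off hy, spliceStep_off hy, spliceStep_off hy]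

theorem contract_eq_addVertex_delete [Finite H] (hh : G.pair h ≠ h) (htriv : G.IsTrivialLoop h)
    (hunt : G.IsUntwistedLoop h) (hin : G.HasInnerFace h) :
    G.contract h hh = (G.delete h hh).addVertex := by
  have hcontract := isSplice_splice (pairsCrosses_strand hh)
  have hdelete := isSplice_splice (pairsCrosses_flip hh)
  have arc_eq : (G.contract h hh).arc = (G.delete h hh).arc := by
    funext x
    exact (Subtype.val_injective.prodMap Function.injective_id)
      (hin.spliceArc_strand_eq hh (x := (x.1.1, x.2)) (not_onEdge x.1))
  have isolated_eq : (G.contract h hh).isolated = (G.delete h hh).isolated + 1 := by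
    have vertices : (G.contract h hh).numVertices = (G.delete h hh).numVertices + 1 :=
      (hcontract.numVertices_of_untwisted htriv hunt).trans
        (congrArg (· + 1) hdelete.numVertices_of_flip.symm)
    rw [numVertices_eq, numVertices_eq, vertexSetoid, arcSetoid, arc_eq] at vertices
    exact Nat.add_left_cancel vertices
  exact eq_of_pair_eq (fun _ => rfl) arc_eq isolated_eq

end InnerFace

end RibbonGraph

open RibbonGraph

theorem mainTheorem3 {H : Type*} [Fintype H] [DecidableEq H] (G : RibbonGraph H)
    (h : H) (hh : G.pair h ≠ h) :
    (G.IsRegular h hh →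
      G.brPoly = (G.cut h).brPoly + (G.contract h hh).brPoly) ∧
    (G.IsBridge h hh →
      G.brPoly = LaurentPolynomial.C (MvPolynomial.X 0 - 1) * (G.cut h).brPoly + (G.contract h hh).brPoly) ∧
    (G.IsTrivialLoop h → G.IsTwistedLoop h →
      G.brPoly = (G.cut h).brPoly
        + LaurentPolynomial.C (MvPolynomial.X 1 - 1) * LaurentPolynomial.T 1 * (G.delete h hh).brPoly) ∧
    (G.IsTrivialLoop h → G.IsUntwistedLoop h → G.HasInnerFace h →
      G.brPoly = (G.cut h).brPoly
        + LaurentPolynomial.C (MvPolynomial.X 1 - 1) * (G.delete h hh).addVertex.brPoly) ∧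
    (G.IsTrivialLoop h → G.IsUntwistedLoop h →
      G.brPoly = (G.cut h).brPoly
        + LaurentPolynomial.C (MvPolynomial.X 1 - 1) * (G.contract h hh).brPoly) := by
  have hcontract : G.IsSplice h G.strand (G.contract h hh) Subtype.val :=
    isSplice_splice (pairsCrosses_strand hh)
  have hdelete : G.IsSplice h flip (G.delete h hh) Subtype.val :=
    isSplice_splice (pairsCrosses_flip hh)
  refine ⟨fun hreg => ?regular, fun hbridge => ?bridge, fun htriv htw => ?twisted,
    fun htriv hunt hin => ?innerFace, fun htriv hunt => ?untwisted⟩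
  case regular =>
    simpa only [pow_zero, map_one, one_mul] using
      hcontract.brPoly_of_not_isLoop hh hreg.1 (i := 0) hreg.numComponents_cut
  case bridge =>
    simpa only [pow_one] using
      hcontract.brPoly_of_not_isLoop hh hbridge.not_isLoop hbridge.numComponents_cut
  case twisted => exact hdelete.brPoly_of_twisted hh htriv htw
  case innerFace =>
    rw [← contract_eq_addVertex_delete hh htriv hunt hin]
    exact hcontract.brPoly_of_untwisted hh htriv hunt
  case untwisted => exact hcontract.brPoly_of_untwisted hh htriv hunt
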